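/- **Theorem.** For a bounded function $V:\mathbb Z\to\mathbb R$ let $H$ be the discrete Schrödinger operator on $\ell^2(\mathbb Z)$, $$[Hu](n)=u(n+1)+u(n-1)+V(n)u(n),$$ with spectrum $\sigma(H)$. For an integer $N$ and $t\in\mathbb R$ define the outside probabilities $$P_r(N,t)=\sum_{n\ge N}|\langle e^{-itH}\delta_0,\delta_n\rangle|^2,\qquad P_l(N,t)=\sum_{n\le -N}|\langle e^{-itH}\delta_0,\delta_n\rangle|^2 ,$$ where $(\delta_n)_{n\in\mathbb Z}$ is the standard orthonormal basis. For $m\in\mathbb Z$ and $z\in\mathbb C$ let $T(m,z)=\begin{pmatrix} z-V(m)&-1\\1&0\end{pmatrix}$, and let the transfer matrix be $$\Phi(n,z)=\begin{cases}T(n,z)\cdots T(1,z)& n\ge1,\\ \mathrm{Id}& n=0,\\ [T(n+1,z)]^{-1}\cdots[T(0,z)]^{-1}& n\le-1,\end{cases}$$ with $\|\cdot\|$ the operator norm on Euclidean $\mathbb C^2$. Then for every real $K\ge4$ there are constants $C,c>0$, depending only on $K$, such that for every bounded $V:\mathbb Z\to\mathbb R$ with $\sigma(H)\subseteq[-K+1,K-1]$,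 every integer $N\ge1$ and every $t>0$, $$P_r(N,t)\le C\left(e^{-cN}+t^4\int_{-K}^{K}\Big(\max_{0\le n\le N-1}\|\Phi(n,E+it^{-1})\|^2\Big)^{-1}dE\right),$$ $$P_l(N,t)\le C\left(e^{-cN}+t^4\int_{-K}^{K}\Big(\max_{-N+1\le n\le 0}\|\Phi(n,E+it^{-1})\|^2\Big)^{-1}dE\right).$$ -/

import Mathlib

open scoped ENNReal NNReal

noncomputable section

/-- The Hilbert space `ℓ²(ℤ)` of square-summable complex sequences. -/
abbrev EllTwo : Type := lp (fun _ : ℤ => ℂ) 2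

/-- The standard basis vector `δ_n` of `ℓ²(ℤ)`. -/
def delta (n : ℤ) : EllTwo := lp.single 2 n (1 : ℂ)

theorem ellTwo_summable (u : EllTwo) : Summable fun n : ℤ => ‖u n‖ ^ 2 := by
  have h := (lp.memℓp u).summable (by norm_num)
  simpa using h

theorem ellTwo_norm_sq (u : EllTwo) : ‖u‖ ^ 2 = ∑' n : ℤ, ‖u n‖ ^ 2 := by
  have h := lp.norm_rpow_eq_tsum (p := 2) (by norm_num) u
  simpa using h

theorem memℓp_two_of_summable {u : ℤ → ℂ} (h : Summable fun n : ℤ => ‖u n‖ ^ 2) :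
    Memℓp (E := fun _ : ℤ => ℂ) u 2 :=
  memℓp_gen (by simpa using h)

/-- The translation `u ↦ u(· + s)` on `ℓ²(ℤ)`. -/
def shiftOp (s : ℤ) : EllTwo →L[ℂ] EllTwo :=
  LinearMap.mkContinuous
    { toFun := fun u => ⟨fun n => u (n + s), memℓp_two_of_summable
        ((ellTwo_summable u).comp_injective (add_left_injective s))⟩
      map_add' := fun _ _ => rfl
      map_smul' := fun _ _ => rfl } 1 (fun u => by
        rw [one_mul]
        refine le_of_eq ((sq_eq_sq₀ (norm_nonneg _) (norm_nonneg _)).1 ?_)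
        rw [ellTwo_norm_sq, ellTwo_norm_sq]
        exact (Equiv.addRight s).tsum_eq (fun n => ‖u n‖ ^ 2))

theorem mul_summable {V : ℤ → ℝ} {M : ℝ} (hM : ∀ n, |V n| ≤ M) (u : EllTwo) :
    Summable fun n : ℤ => ‖(V n : ℂ) * u n‖ ^ 2 := by
  refine Summable.of_nonneg_of_le (fun _ => by positivity) (fun n => ?_)
    ((ellTwo_summable u).mul_left (M ^ 2))
  rw [norm_mul, mul_pow, Complex.norm_real, Real.norm_eq_abs]
  gcongr
  exact hM n

/-- Multiplication by a bounded real potential `V` on `ℓ²(ℤ)`. -/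
def potentialOp (V : ℤ → ℝ) (hV : ∃ M : ℝ, ∀ n, |V n| ≤ M) : EllTwo →L[ℂ] EllTwo :=
  LinearMap.mkContinuousOfExistsBound
    { toFun := fun u => ⟨fun n => (V n : ℂ) * u n,
        memℓp_two_of_summable (mul_summable hV.choose_spec u)⟩
      map_add' := fun u v => by ext n; exact mul_add _ _ _
      map_smul' := fun a u => by ext n; exact mul_left_comm _ _ _ } (by
    obtain ⟨M, hM⟩ := hV
    have hM0 : 0 ≤ M := (abs_nonneg _).trans (hM 0)
    refine ⟨M, fun u => (sq_le_sq₀ (norm_nonneg _) (by positivity)).1 ?_⟩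
    rw [mul_pow, ellTwo_norm_sq, ellTwo_norm_sq, ← tsum_mul_left]
    refine (mul_summable hM u).tsum_le_tsum (fun n => ?_) ((ellTwo_summable u).mul_left _)
    change ‖(V n : ℂ) * u n‖ ^ 2 ≤ _
    rw [norm_mul, mul_pow, Complex.norm_real, Real.norm_eq_abs]
    gcongr
    exact hM n)

/-- The discrete Schrödinger operator with bounded real potential `V`, as a bounded operator
on `ℓ²(ℤ)`. -/
def schrodingerOp (V : ℤ → ℝ) (hV : ∃ M : ℝ, ∀ n, |V n| ≤ M) : EllTwo →L[ℂ] EllTwo :=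
  shiftOp 1 + shiftOp (-1) + potentialOp V hV

theorem schrodingerOp_apply (V : ℤ → ℝ) (hV : ∃ M : ℝ, ∀ n, |V n| ≤ M) (u : EllTwo) (n : ℤ) :
    schrodingerOp V hV u n = u (n + 1) + u (n - 1) + (V n : ℂ) * u n := rfl

/-- The propagator `e^{-itH}`. -/
def propagator (H : EllTwo →L[ℂ] EllTwo) (t : ℝ) : EllTwo →L[ℂ] EllTwo :=
  NormedSpace.exp ((-(Complex.I * (t : ℂ))) • H)

/-- The probability `|⟨e^{-itH} δ_0, δ_n⟩|²` of finding the state at site `n` at time `t`. -/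
def siteProb (H : EllTwo →L[ℂ] EllTwo) (t : ℝ) (n : ℤ) : ℝ :=
  ‖inner ℂ (propagator H t (delta 0)) (delta n)‖ ^ 2

theorem siteProb_summable (H : EllTwo →L[ℂ] EllTwo) (t : ℝ) : Summable (siteProb H t) := by
  refine (ellTwo_summable (propagator H t (delta 0))).congr fun n => ?_
  simp [siteProb, delta, lp.inner_single_right]

/-- The right outside probability `∑_{n ≥ N} |⟨e^{-itH} δ_0, δ_n⟩|²`. -/
def rightOutsideProb (H : EllTwo →L[ℂ] EllTwo) (N : ℤ) (t : ℝ) : ℝ :=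
  ∑' n : Set.Ici N, siteProb H t n

/-- The left outside probability `∑_{n ≤ -N} |⟨e^{-itH} δ_0, δ_n⟩|²`. -/
def leftOutsideProb (H : EllTwo →L[ℂ] EllTwo) (N : ℤ) (t : ℝ) : ℝ :=
  ∑' n : Set.Iic (-N), siteProb H t n

/-- The one-step transfer matrix `T(m, z)`. -/
def stepMatrix (V : ℤ → ℝ) (m : ℤ) (z : ℂ) : Matrix (Fin 2) (Fin 2) ℂ :=
  !![z - (V m : ℂ), -1; 1, 0]

/-- `T(k, z) ⋯ T(1, z)`. -/
def forwardProd (V : ℤ → ℝ) (z : ℂ) : ℕ → Matrix (Fin 2) (Fin 2) ℂ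
  | 0 => 1
  | k + 1 => stepMatrix V ((k : ℤ) + 1) z * forwardProd V z k

/-- `T(-k + 1, z)⁻¹ ⋯ T(0, z)⁻¹`. -/
def backwardProd (V : ℤ → ℝ) (z : ℂ) : ℕ → Matrix (Fin 2) (Fin 2) ℂ
  | 0 => 1
  | k + 1 => (stepMatrix V (-(k : ℤ)) z)⁻¹ * backwardProd V z k

/-- The transfer matrix `Φ(n, z)`, for `n ∈ ℤ`. -/
def transferMatrix (V : ℤ → ℝ) (n : ℤ) (z : ℂ) : Matrix (Fin 2) (Fin 2) ℂ :=
  if 0 ≤ n then forwardProd V z n.toNat else backwardProd V z (-n).toNat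

/-- The operator norm of `Φ(n, z)` on `ℂ²` with its Euclidean norm. -/
def transferNorm (V : ℤ → ℝ) (n : ℤ) (z : ℂ) : ℝ≥0 :=
  ‖Matrix.toEuclideanCLM (n := Fin 2) (𝕜 := ℂ) (transferMatrix V n z)‖₊

/-- The maximum of `‖Φ(n, z)‖²` over a (nonempty) finite set `S` of integers `n`. -/
def maxTransferNormSq (V : ℤ → ℝ) (S : Finset ℤ) (z : ℂ) : ℝ :=
  ((S.sup fun n => transferNorm V n z ^ 2 : ℝ≥0) : ℝ)

end

/-! The amplitude at a site `n ≠ 0` is recovered from the resolvent column `u_E = (E + iε - H)⁻¹ δ₀`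
on the line `Im z = ε`. The damped amplitude `e^{-εs} (e^{-isH} δ₀)(n)` on `s > 0` has Fourier
transform `i u_E(n)` with `E = -2πw`, and Fourier inversion bounds the amplitude at time `t` by
`e^{εt} / 2π` times `∫ |u_E(n)| dE` (`norm_propagator_apply_le_integral`). With `ε = 1/t` the
prefactor is at most 1. Energies with `|E| ≥ K` contribute exponentially little in `|n|`, because
`‖H‖ ≤ K - 1` and `H` has range one (`norm_resolvent_apply_le_of_le_abs`). On `[-K, K]`
Cauchy–Schwarz turns the square of the integral into an integral of `|u_E(n)|²`. For `t ≤ 1` the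
exponential series alone gives exponential decay (`norm_propagator_apply_le_of_le_one`).

It remains to bound the tail `∑_{n ≥ N} |u_E(n)|²` for fixed `E`
(`tsum_tail_mul_transferFrobSq_le`). Off the origin `u_E` solves a three-term recurrence whose
coefficients have imaginary part `ε`, so the current `Im (x_{k+1} conj x_k)` increases by `ε
|x_{k+1}|²` at each step. For the square-summable solution it tends to 0, hence equals `-ε S` with
`S` the tail beyond `k`. For the solutions with initial data `(1, 0)` and `(0, 1)`, which form the
transfer matrix, it starts at 0 and stays nonnegative. Opposite signs make the two vectors
transversal, and the constant Wronskian then gives `S ‖Φ(k)‖² ≤ C ε⁻² (|x₀|² + |x₁|²)`. As `‖u_E‖ ≤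
1/ε = t`, the right side is of order `t⁴`; choosing the `k < N` where `‖Φ(k)‖` is largest gives the
theorem. -/

noncomputable section

open ComplexConjugate Filter Topology MeasureTheory

/-! ### Half-line recurrences: Wronskian, current, and the tail estimate. -/

/-- `x` solves the three-term recurrence `x (n + 2) = a n * x (n + 1) - x n` on `ℕ`. -/
def IsRecurrenceSol (a x : ℕ → ℂ) : Prop :=
  ∀ n, x (n + 2) = a n * x (n + 1) - x n

namespace IsRecurrenceSol

variable {a x y : ℕ → ℂ} {ε : ℝ}

theorem wronskian (hx : IsRecurrenceSol a x) (hy : IsRecurrenceSol a y) (n : ℕ) :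
    x (n + 1) * y n - x n * y (n + 1) = x 1 * y 0 - x 0 * y 1 := by
  induction n with
  | zero => simp
  | succ n ih => rw [← ih, hx n, hy n]; ring

/-- Multiplying the recurrence by `conj x_{n+1}` gives `a_n |x_{n+1}|² - x_n conj x_{n+1}`, and
conjugating the last product flips the sign of its imaginary part. -/
theorem im_step (hx : IsRecurrenceSol a x) (ha : ∀ n, (a n).im = ε) (n : ℕ) :
    (x (n + 2) * conj (x (n + 1))).im =
      (x (n + 1) * conj (x n)).im + ε * ‖x (n + 1)‖ ^ 2 := by
  rw [hx n, ← ha n, ← Complex.normSq_eq_norm_sq, Complex.normSq_apply]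
  simp
  ring

theorem im_eq_add_sum (hx : IsRecurrenceSol a x) (ha : ∀ n, (a n).im = ε) (k m : ℕ) :
    (x (k + m + 1) * conj (x (k + m))).im =
      (x (k + 1) * conj (x k)).im + ε * ∑ j ∈ Finset.range m, ‖x (k + 1 + j)‖ ^ 2 := by
  induction m with
  | zero => simp
  | succ m ih =>
    have h := hx.im_step ha (k + m)
    rw [Finset.sum_range_succ, mul_add, ← add_assoc (Complex.im _), ← ih,
      show k + 1 + m = k + m + 1 by ring]
    exact h

theorem im_nonneg (hx : IsRecurrenceSol a x) (ha : ∀ n, (a n).im = ε) (hε : 0 ≤ ε)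
    (h0 : (x 1 * conj (x 0)).im = 0) (k : ℕ) : 0 ≤ (x (k + 1) * conj (x k)).im := by
  have h := hx.im_eq_add_sum ha 0 k
  simp only [zero_add] at h
  rw [h, h0, zero_add]
  positivity

/-- Square-summability sends the current to 0 at infinity, so all the increments beyond `k` must
cancel its value at `k`. -/
theorem im_eq_neg_tsum (hx : IsRecurrenceSol a x) (ha : ∀ n, (a n).im = ε)
    (hs : Summable fun n => ‖x n‖ ^ 2) (k : ℕ) :
    (x (k + 1) * conj (x k)).im = -(ε * ∑' j, ‖x (k + 1 + j)‖ ^ 2) := by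
  have hs' : Summable fun j => ‖x (k + 1 + j)‖ ^ 2 := by
    have := (summable_nat_add_iff (k + 1)).2 hs
    refine this.congr fun j => ?_
    rw [add_comm]
  have hx0 : Tendsto x atTop (𝓝 0) := by
    have := hs.tendsto_atTop_zero
    rw [tendsto_zero_iff_norm_tendsto_zero]
    have h2 := this.sqrt
    simpa using h2
  have h1 : Tendsto (fun m => (x (k + m + 1) * conj (x (k + m))).im) atTop (𝓝 0) := by
    have ht : Tendsto (fun m => k + m) atTop atTop :=
      tendsto_atTop_mono (fun m => Nat.le_add_left m k) tendsto_id
    have h2 : Tendsto (fun m => x (k + m)) atTop (𝓝 0) := hx0.comp ht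
    have h3 : Tendsto (fun m => x (k + m + 1)) atTop (𝓝 0) :=
      hx0.comp ((tendsto_add_atTop_nat 1).comp ht)
    have h4 := h3.mul ((Complex.continuous_conj.tendsto 0).comp h2)
    have h5 := (Complex.continuous_im.tendsto _).comp h4
    simp only [map_zero, mul_zero, Complex.zero_im] at h5
    exact h5
  have h2 : Tendsto (fun m => (x (k + m + 1) * conj (x (k + m))).im) atTop
      (𝓝 ((x (k + 1) * conj (x k)).im + ε * ∑' j, ‖x (k + 1 + j)‖ ^ 2)) := by
    simp_rw [hx.im_eq_add_sum ha k]
    exact (hs'.hasSum.tendsto_sum_nat.const_mul ε).const_add _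
  have := tendsto_nhds_unique h1 h2
  linarith

end IsRecurrenceSol

/-- If `Im (a₁ conj a₀)` and `Im (w₁ conj w₀)` have opposite signs, then the vectors `a` and `w`
are transversal, quantitatively. -/
theorem sq_im_mul_le_of_opposite_signs (a₀ a₁ w₀ w₁ : ℂ) (ha : (a₁ * conj a₀).im ≤ 0)
    (hw : 0 ≤ (w₁ * conj w₀).im) :
    (a₁ * conj a₀).im ^ 2 * (‖w₀‖ ^ 2 + ‖w₁‖ ^ 2) ≤
      (‖a₀‖ ^ 2 + ‖a₁‖ ^ 2) * ‖a₁ * w₀ - a₀ * w₁‖ ^ 2 := by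
  rcases ha.eq_or_lt with h0 | hlt
  · rw [h0]; simp only [ne_eq, OfNat.ofNat_ne_zero, not_false_eq_true, zero_pow, zero_mul]
    positivity
  set J := (a₁ * conj a₀).im with hJ
  -- When `J ≠ 0` the vectors `a` and `conj a` form a basis; up to the factor `2iJ`, `α` and `β` are
  -- the coordinates of `w` in it. `β` is the Wronskian, and the sign condition serves to bound `α`
  -- by `β`.
  set α := w₁ * conj a₀ - w₀ * conj a₁ with hα
  set β := a₁ * w₀ - a₀ * w₁ with hβ
  have hD : a₁ * conj a₀ - a₀ * conj a₁ = 2 * Complex.I * J := by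
    rw [hJ]
    apply Complex.ext <;> simp <;> ring
  have h0 : 2 * Complex.I * J * w₀ = α * a₀ + β * conj a₀ := by
    rw [← hD, hα, hβ]; ring
  have h1 : 2 * Complex.I * J * w₁ = α * a₁ + β * conj a₁ := by
    rw [← hD, hα, hβ]; ring
  have hαβ : ‖α‖ ≤ ‖β‖ := by
    have key : (‖α‖ ^ 2 - ‖β‖ ^ 2) * J = 4 * J ^ 2 * (w₁ * conj w₀).im := by
      rw [hα, hβ, hJ, ← Complex.normSq_eq_norm_sq, ← Complex.normSq_eq_norm_sq,
        Complex.normSq_apply, Complex.normSq_apply]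
      simp
      ring
    have h2 : 0 ≤ (‖α‖ ^ 2 - ‖β‖ ^ 2) * J := by rw [key]; positivity
    have h3 : ‖α‖ ^ 2 ≤ ‖β‖ ^ 2 := by nlinarith
    exact (sq_le_sq₀ (norm_nonneg _) (norm_nonneg _)).1 h3
  have comp : ∀ w b : ℂ, 2 * Complex.I * J * w = α * b + β * conj b →
      J ^ 2 * ‖w‖ ^ 2 ≤ ‖b‖ ^ 2 * ‖β‖ ^ 2 := by
    intro w b h
    have h2 : 2 * |J| * ‖w‖ ≤ 2 * (‖b‖ * ‖β‖) := by
      calc 2 * |J| * ‖w‖ = ‖2 * Complex.I * J * w‖ := by simp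
        _ = ‖α * b + β * conj b‖ := by rw [h]
        _ ≤ ‖α‖ * ‖b‖ + ‖β‖ * ‖b‖ := by
          refine (norm_add_le _ _).trans ?_
          simp
        _ ≤ ‖β‖ * ‖b‖ + ‖β‖ * ‖b‖ := by gcongr
        _ = _ := by ring
    have h3 : |J| * ‖w‖ ≤ ‖b‖ * ‖β‖ := by linarith
    have h4 := pow_le_pow_left₀ (by positivity) h3 2
    rwa [mul_pow, mul_pow, sq_abs] at h4
  have := comp w₀ a₀ h0
  have := comp w₁ a₁ h1
  nlinarith

/-- The solution of the recurrence with prescribed initial values. -/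
def recurrenceSol (a : ℕ → ℂ) (x₀ x₁ : ℂ) : ℕ → ℂ
  | 0 => x₀
  | 1 => x₁
  | n + 2 => a n * recurrenceSol a x₀ x₁ (n + 1) - recurrenceSol a x₀ x₁ n

theorem isRecurrenceSol_recurrenceSol (a : ℕ → ℂ) (x₀ x₁ : ℂ) :
    IsRecurrenceSol a (recurrenceSol a x₀ x₁) := fun n => by
  rw [recurrenceSol]

/-- The squared Frobenius norm of the transfer matrix of the recurrence. -/
def transferFrobSq (a : ℕ → ℂ) (k : ℕ) : ℝ :=
  (‖recurrenceSol a 1 0 k‖ ^ 2 + ‖recurrenceSol a 1 0 (k + 1)‖ ^ 2) +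
    (‖recurrenceSol a 0 1 k‖ ^ 2 + ‖recurrenceSol a 0 1 (k + 1)‖ ^ 2)

theorem norm_sub_sq_le (a b : ℂ) : ‖a - b‖ ^ 2 ≤ 2 * ‖a‖ ^ 2 + 2 * ‖b‖ ^ 2 := by
  have h := pow_le_pow_left₀ (norm_nonneg _) (norm_sub_le a b) 2
  nlinarith [sq_nonneg (‖a‖ - ‖b‖)]

/-- A square-summable solution is small where the transfer matrix is large. -/
theorem tsum_tail_mul_transferFrobSq_le {a x : ℕ → ℂ} {ε B : ℝ} (hε : 0 < ε)
    (ha : ∀ n, (a n).im = ε) (hB : ∀ n, ‖a n‖ ≤ B) (hx : IsRecurrenceSol a x)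
    (hs : Summable fun n => ‖x n‖ ^ 2) (k : ℕ) :
    (∑' j, ‖x (k + 1 + j)‖ ^ 2) * transferFrobSq a k ≤
      (2 * B ^ 2 + 3) * ε⁻¹ ^ 2 * (‖x 0‖ ^ 2 + ‖x 1‖ ^ 2) := by
  have hs' : Summable fun j => ‖x (k + 1 + j)‖ ^ 2 := by
    refine ((summable_nat_add_iff (k + 1)).2 hs).congr fun j => ?_
    rw [add_comm]
  set S := ∑' j, ‖x (k + 1 + j)‖ ^ 2 with hS
  have hS0 : 0 ≤ S := tsum_nonneg fun _ => by positivity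
  have hB0 : 0 ≤ B := (norm_nonneg _).trans (hB 0)
  have hJ := hx.im_eq_neg_tsum ha hs k
  rw [← hS] at hJ
  have h1 : ‖x (k + 1)‖ ^ 2 + ‖x (k + 2)‖ ^ 2 ≤ S := by
    have := hs'.sum_le_tsum (Finset.range 2) (fun _ _ => by positivity)
    simp only [Finset.sum_range_succ, Finset.sum_range_zero, zero_add, add_zero] at this
    exact this
  -- `x k` lies outside the tail `S`; running the recurrence backwards expresses it by the first two
  -- terms of the tail.
  have h2 : ‖x k‖ ^ 2 ≤ 2 * B ^ 2 * ‖x (k + 1)‖ ^ 2 + 2 * ‖x (k + 2)‖ ^ 2 := by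
    have h : x k = a k * x (k + 1) - x (k + 2) := by rw [hx k]; ring
    rw [h]
    refine (norm_sub_sq_le _ _).trans ?_
    rw [norm_mul, mul_pow]
    have := pow_le_pow_left₀ (norm_nonneg _) (hB k) 2
    have := mul_le_mul_of_nonneg_right this (sq_nonneg ‖x (k + 1)‖)
    linarith
  have h3 : ‖x k‖ ^ 2 + ‖x (k + 1)‖ ^ 2 ≤ (2 * B ^ 2 + 3) * S := by
    nlinarith [sq_nonneg ‖x (k + 1)‖, sq_nonneg ‖x (k + 2)‖, sq_nonneg B,
      mul_nonneg (sq_nonneg B) (sq_nonneg ‖x (k + 2)‖),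
      mul_le_mul_of_nonneg_left h1 (sq_nonneg B)]
  -- The squared current supplies `S²` while `‖x k‖² + ‖x (k + 1)‖²` costs only one `S`, so one
  -- power of `S` survives.
  have main : ∀ w₀ w₁ : ℂ, (w₁ * conj w₀).im = 0 →
      ε ^ 2 * S ^ 2 * (‖recurrenceSol a w₀ w₁ k‖ ^ 2 + ‖recurrenceSol a w₀ w₁ (k + 1)‖ ^ 2) ≤
        (2 * B ^ 2 + 3) * S * ‖x 1 * w₀ - x 0 * w₁‖ ^ 2 := by
    intro w₀ w₁ hw
    have hsol := isRecurrenceSol_recurrenceSol a w₀ w₁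
    have hp : 0 ≤ (recurrenceSol a w₀ w₁ (k + 1) * conj (recurrenceSol a w₀ w₁ k)).im :=
      hsol.im_nonneg ha hε.le hw k
    have hn : (x (k + 1) * conj (x k)).im ≤ 0 := by
      rw [hJ]; exact neg_nonpos.2 (by positivity)
    have h := sq_im_mul_le_of_opposite_signs _ _ _ _ hn hp
    rw [hx.wronskian hsol, hJ, neg_sq, mul_pow] at h
    refine h.trans ?_
    have : recurrenceSol a w₀ w₁ 0 = w₀ ∧ recurrenceSol a w₀ w₁ 1 = w₁ := ⟨rfl, rfl⟩
    rw [this.1, this.2]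
    gcongr
  have m1 := main 1 0 (by simp)
  have m2 := main 0 1 (by simp)
  simp only [mul_one, mul_zero, sub_zero, zero_sub, norm_neg] at m1 m2
  rcases hS0.eq_or_lt with h0 | hpos
  · rw [← h0, zero_mul]; positivity
  have h4 : ε ^ 2 * S * (S * transferFrobSq a k) ≤
      ε ^ 2 * S * ((2 * B ^ 2 + 3) * ε⁻¹ ^ 2 * (‖x 0‖ ^ 2 + ‖x 1‖ ^ 2)) := by
    have : ε ^ 2 * S * ((2 * B ^ 2 + 3) * ε⁻¹ ^ 2 * (‖x 0‖ ^ 2 + ‖x 1‖ ^ 2)) =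
        (2 * B ^ 2 + 3) * S * (‖x 0‖ ^ 2 + ‖x 1‖ ^ 2) := by
      field_simp
    rw [this, transferFrobSq]
    nlinarith
  exact le_of_mul_le_mul_left h4 (by positivity)

/-! ### Transfer matrices in terms of recurrence solutions. -/

theorem forwardProd_eq (V : ℤ → ℝ) (z : ℂ) (k : ℕ) :
    forwardProd V z k =
      !![recurrenceSol (fun n => z - V (n + 1)) 0 1 (k + 1),
          recurrenceSol (fun n => z - V (n + 1)) 1 0 (k + 1);
        recurrenceSol (fun n => z - V (n + 1)) 0 1 k,
          recurrenceSol (fun n => z - V (n + 1)) 1 0 k] := by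
  induction k with
  | zero => simp [forwardProd, recurrenceSol, Matrix.one_fin_two]
  | succ k ih =>
    rw [forwardProd, ih, stepMatrix]
    simp [recurrenceSol, sub_eq_add_neg]

theorem stepMatrix_inv (V : ℤ → ℝ) (m : ℤ) (z : ℂ) :
    (stepMatrix V m z)⁻¹ = !![0, 1; -1, z - (V m : ℂ)] := by
  apply Matrix.inv_eq_left_inv
  simp [stepMatrix, Matrix.one_fin_two]

/-- The reflected sequence `y_n = u(1 - n)` satisfies the same type of recurrence with potential
`V(-n)`, and the state `(u(1 - k), u(-k))` becomes `(y_k, y_{k+1})`. The left half-line is thus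
reduced to the right one. -/
theorem backwardProd_eq (V : ℤ → ℝ) (z : ℂ) (k : ℕ) :
    backwardProd V z k =
      !![recurrenceSol (fun n => z - V (-n)) 1 0 k,
          recurrenceSol (fun n => z - V (-n)) 0 1 k;
        recurrenceSol (fun n => z - V (-n)) 1 0 (k + 1),
          recurrenceSol (fun n => z - V (-n)) 0 1 (k + 1)] := by
  induction k with
  | zero => simp [backwardProd, recurrenceSol, Matrix.one_fin_two]
  | succ k ih =>
    rw [backwardProd, ih, stepMatrix_inv]
    simp [recurrenceSol, sub_eq_add_neg, add_comm]

theorem sq_norm_toEuclideanCLM_le (a b c d : ℂ) :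
    ‖Matrix.toEuclideanCLM (n := Fin 2) (𝕜 := ℂ) !![a, b; c, d]‖ ^ 2 ≤
      ‖a‖ ^ 2 + ‖b‖ ^ 2 + ‖c‖ ^ 2 + ‖d‖ ^ 2 := by
  rw [← Real.le_sqrt (norm_nonneg _) (by positivity)]
  refine ContinuousLinearMap.opNorm_le_bound _ (Real.sqrt_nonneg _) fun v => ?_
  rw [EuclideanSpace.norm_eq v, ← Real.sqrt_mul (by positivity), EuclideanSpace.norm_eq]
  apply Real.sqrt_le_sqrt
  have cs : ∀ p q : ℂ, ‖p * v 0 + q * v 1‖ ^ 2 ≤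
      (‖p‖ ^ 2 + ‖q‖ ^ 2) * (‖v 0‖ ^ 2 + ‖v 1‖ ^ 2) := by
    intro p q
    have h := pow_le_pow_left₀ (norm_nonneg _) (norm_add_le (p * v 0) (q * v 1)) 2
    rw [norm_mul, norm_mul] at h
    nlinarith [sq_nonneg (‖p‖ * ‖v 1‖ - ‖q‖ * ‖v 0‖)]
  have h1 := cs a b
  have h2 := cs c d
  simp only [Fin.sum_univ_two, Matrix.ofLp_toEuclideanCLM, Matrix.mulVec, dotProduct,
    Matrix.of_apply, Matrix.cons_val_zero, Matrix.cons_val_one, Matrix.cons_val',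
    Matrix.cons_val_fin_one]
  linarith

theorem sq_transferNorm_natCast_le (V : ℤ → ℝ) (z : ℂ) (k : ℕ) :
    (transferNorm V k z : ℝ) ^ 2 ≤ transferFrobSq (fun n => z - V (n + 1)) k := by
  rw [transferNorm, transferMatrix, if_pos (Int.natCast_nonneg k), Int.toNat_natCast,
    forwardProd_eq, coe_nnnorm, transferFrobSq]
  refine (sq_norm_toEuclideanCLM_le _ _ _ _).trans (le_of_eq ?_)
  ring

theorem sq_transferNorm_neg_natCast_le (V : ℤ → ℝ) (z : ℂ) (k : ℕ) :
    (transferNorm V (-k) z : ℝ) ^ 2 ≤ transferFrobSq (fun n => z - V (-n)) k := by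
  have h : transferMatrix V (-k) z = backwardProd V z k := by
    rcases k.eq_zero_or_pos with rfl | hk
    · simp [transferMatrix, forwardProd, backwardProd]
    · rw [transferMatrix, if_neg (by omega)]
      simp
  rw [transferNorm, h, backwardProd_eq, coe_nnnorm, transferFrobSq]
  refine (sq_norm_toEuclideanCLM_le _ _ _ _).trans (le_of_eq ?_)
  ring

/-! ### The operator: self-adjointness, norm, and finite range. -/

theorem delta_apply (m n : ℤ) : (delta m : EllTwo) n = if n = m then 1 else 0 := by
  rw [delta, lp.single_apply, Pi.single_apply]

theorem norm_delta (m : ℤ) : ‖delta m‖ = 1 := by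
  rw [delta, lp.norm_single (by norm_num), norm_one]

theorem siteProb_eq (H : EllTwo →L[ℂ] EllTwo) (t : ℝ) (n : ℤ) :
    siteProb H t n = ‖(propagator H t (delta 0)) n‖ ^ 2 := by
  simp [siteProb, delta, lp.inner_single_right]

theorem norm_apply_le (u : EllTwo) (n : ℤ) : ‖u n‖ ≤ ‖u‖ :=
  lp.norm_apply_le_norm (by norm_num) u n

/-- Evaluation at a site, as a continuous linear functional on `ℓ²(ℤ)`. -/
def evalAt (n : ℤ) : EllTwo →L[ℂ] ℂ := innerSL ℂ (delta n)

theorem evalAt_apply (n : ℤ) (u : EllTwo) : evalAt n u = u n := by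
  simp [evalAt, delta, lp.inner_single_left]

theorem isSelfAdjoint_schrodingerOp (V : ℤ → ℝ) (hV : ∃ M : ℝ, ∀ n, |V n| ≤ M) :
    IsSelfAdjoint (schrodingerOp V hV) := by
  rw [ContinuousLinearMap.isSelfAdjoint_iff_isSymmetric]
  intro u v
  have hshift : ∀ (s : ℤ) (u v : EllTwo), inner ℂ (shiftOp s u) v = inner ℂ u (shiftOp (-s) v) := by
    intro s u v
    rw [lp.inner_eq_tsum, lp.inner_eq_tsum]
    rw [← (Equiv.addRight s).tsum_eq fun n => inner ℂ (u n) (shiftOp (-s) v n)]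
    refine tsum_congr fun n => ?_
    change inner ℂ (u (n + s)) (v n) = inner ℂ (u (n + s)) (v (n + s + -s))
    rw [add_neg_cancel_right]
  have hpot : inner ℂ (potentialOp V hV u) v = inner ℂ u (potentialOp V hV v) := by
    rw [lp.inner_eq_tsum, lp.inner_eq_tsum]
    refine tsum_congr fun n => ?_
    change inner ℂ ((V n : ℂ) * u n) (v n) = inner ℂ (u n) ((V n : ℂ) * v n)
    simp only [RCLike.inner_apply, map_mul, Complex.conj_ofReal]
    ring
  change inner ℂ (shiftOp 1 u + shiftOp (-1) u + potentialOp V hV u) v =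
    inner ℂ u (shiftOp 1 v + shiftOp (-1) v + potentialOp V hV v)
  rw [inner_add_left, inner_add_left, inner_add_right, inner_add_right, hshift, hshift, hpot,
    neg_neg]
  ring

/-- The spectral radius of a self-adjoint operator is its norm. The proof uses the spectral
hypothesis only through this bound. -/
theorem norm_le_of_spectrum_subset {H : EllTwo →L[ℂ] EllTwo} (hH : IsSelfAdjoint H) {r : ℝ}
    (hr : 0 ≤ r)
    (hs : spectrum ℂ H ⊆ (fun x : ℝ => (x : ℂ)) '' Set.Icc (-r) r) : ‖H‖ ≤ r := by
  have h1 : spectralRadius ℂ H ≤ ENNReal.ofReal r := by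
    refine iSup₂_le fun z hz => ?_
    obtain ⟨x, hx, rfl⟩ := hs hz
    rw [← enorm_eq_nnnorm, ← ofReal_norm, Complex.norm_real]
    exact ENNReal.ofReal_le_ofReal (abs_le.2 hx)
  rw [hH.spectralRadius_eq_nnnorm, ← enorm_eq_nnnorm, ← ofReal_norm] at h1
  exact (ENNReal.ofReal_le_ofReal_iff hr).1 h1

theorem abs_potential_le (V : ℤ → ℝ) (hV : ∃ M : ℝ, ∀ n, |V n| ≤ M) (n : ℤ) :
    |V n| ≤ ‖schrodingerOp V hV‖ := by
  have h := (norm_apply_le (schrodingerOp V hV (delta n)) n).trans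
    ((schrodingerOp V hV).le_opNorm (delta n))
  rw [schrodingerOp_apply, norm_delta, mul_one] at h
  simpa [delta_apply] using h

/-- The vector `u` vanishes at all sites of absolute value at least `k`. -/
def SupportedBelow (k : ℕ) (u : EllTwo) : Prop := ∀ n : ℤ, k ≤ n.natAbs → u n = 0

theorem supportedBelow_delta : SupportedBelow 1 (delta 0) := fun n hn => by
  rw [delta_apply, if_neg (by rintro rfl; simp at hn)]

theorem SupportedBelow.schrodingerOp {V : ℤ → ℝ} (hV : ∃ M : ℝ, ∀ n, |V n| ≤ M) {k : ℕ}
    {u : EllTwo} (h : SupportedBelow k u) : SupportedBelow (k + 1) (schrodingerOp V hV u) := by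
  intro n hn
  rw [schrodingerOp_apply, h (n + 1) (by omega), h (n - 1) (by omega), h n (by omega)]
  simp

theorem supportedBelow_pow_delta {V : ℤ → ℝ} (hV : ∃ M : ℝ, ∀ n, |V n| ≤ M) (k : ℕ) :
    SupportedBelow (k + 1) ((schrodingerOp V hV ^ k) (delta 0)) := by
  induction k with
  | zero => simpa using supportedBelow_delta
  | succ k ih => rw [pow_succ']; exact ih.schrodingerOp hV

/-! ### Size and off-diagonal decay of a resolvent column. -/

section Resolvent

variable {V : ℤ → ℝ} {hV : ∃ M : ℝ, ∀ n, |V n| ≤ M} {z : ℂ} {u : EllTwo}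

/-- Iterating `z u = δ₀ + H u` leaves a combination of `H^j δ₀` with `j < k`, and each `H` enlarges
the support by one site. Hence `z^k u = H^k u` at distance `k`, which is the source of the decay in
`norm_apply_le_of_norm_le`. -/
theorem supportedBelow_pow_smul_sub (hu : z • u - schrodingerOp V hV u = delta 0) (k : ℕ) :
    SupportedBelow k (z ^ k • u - (schrodingerOp V hV ^ k) u) := by
  induction k with
  | zero => intro n _; simp
  | succ k ih =>
    have h : z ^ (k + 1) • u - (schrodingerOp V hV ^ (k + 1)) u =
        z ^ k • delta 0 +
          schrodingerOp V hV (z ^ k • u - (schrodingerOp V hV ^ k) u) := by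
      rw [← hu, pow_succ, pow_succ' (schrodingerOp V hV), map_sub, map_smul, smul_sub, smul_smul]
      simp
    intro n hn
    rw [h, lp.coeFn_add, Pi.add_apply, ih.schrodingerOp hV n hn, lp.coeFn_smul, Pi.smul_apply,
      supportedBelow_delta n (by omega)]
    simp

/-- Since `⟨u, H u⟩` is real, `Im ⟨u, v⟩ = Im z ‖u‖²`; Cauchy–Schwarz finishes. -/
theorem norm_le_inv_of_im {H : EllTwo →L[ℂ] EllTwo} (hH : IsSelfAdjoint H) {v : EllTwo}
    (hz : 0 < z.im) (hu : z • u - H u = v) : ‖u‖ ≤ z.im⁻¹ * ‖v‖ := by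
  have h1 : (inner ℂ u (H u)).im = 0 := by
    have hs := (ContinuousLinearMap.isSelfAdjoint_iff_isSymmetric.1 hH)
    have := hs u u
    rw [← Complex.conj_eq_iff_im, inner_conj_symm]
    exact this
  have h2 : (inner ℂ u v).im = z.im * ‖u‖ ^ 2 := by
    rw [← hu, inner_sub_right, inner_smul_right, Complex.sub_im, h1, inner_self_eq_norm_sq_to_K]
    have : ((‖u‖ : ℂ) ^ 2) = ((‖u‖ ^ 2 : ℝ) : ℂ) := by push_cast; rfl
    change (z * (‖u‖ : ℂ) ^ 2).im - 0 = _
    rw [this, Complex.im_mul_ofReal, sub_zero]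
  have h3 : z.im * ‖u‖ ^ 2 ≤ ‖u‖ * ‖v‖ := by
    rw [← h2]
    exact (le_abs_self _).trans ((Complex.abs_im_le_norm _).trans (norm_inner_le_norm _ _))
  rcases (norm_nonneg u).eq_or_lt with h0 | hpos
  · rw [← h0]; positivity
  · rw [inv_mul_eq_div, le_div_iff₀ hz]
    have : ‖u‖ * (‖u‖ * z.im) ≤ ‖u‖ * ‖v‖ := by nlinarith
    exact le_of_mul_le_mul_left this hpos

theorem norm_apply_le_of_norm_le {r : ℝ} (hr : ‖schrodingerOp V hV‖ ≤ r) (hz : r < ‖z‖)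
    (hu : z • u - schrodingerOp V hV u = delta 0) (n : ℤ) :
    ‖u n‖ ≤ (r / ‖z‖) ^ n.natAbs * (‖z‖ - r)⁻¹ := by
  have hr0 : 0 ≤ r := (norm_nonneg _).trans hr
  have hz0 : 0 < ‖z‖ := hr0.trans_lt hz
  have h1 : ‖u‖ ≤ (‖z‖ - r)⁻¹ := by
    rw [← one_div, le_div_iff₀ (by linarith)]
    have h2 : ‖z • u‖ ≤ 1 + r * ‖u‖ := by
      have : z • u = delta 0 + schrodingerOp V hV u := by rw [← hu]; abel
      rw [this]
      refine (norm_add_le _ _).trans ?_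
      rw [norm_delta]
      gcongr
      exact (ContinuousLinearMap.le_opNorm _ _).trans (by gcongr)
    rw [norm_smul] at h2
    linarith
  set k := n.natAbs with hk
  have h3 : z ^ k * u n = ((schrodingerOp V hV ^ k) u) n := by
    have := supportedBelow_pow_smul_sub hu k n hk.le
    rw [lp.coeFn_sub, Pi.sub_apply, sub_eq_zero] at this
    exact this
  have h4 : ‖z‖ ^ k * ‖u n‖ ≤ r ^ k * (‖z‖ - r)⁻¹ := by
    rw [← norm_pow, ← norm_mul, h3]
    refine (norm_apply_le _ _).trans ((ContinuousLinearMap.le_opNorm _ _).trans ?_)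
    have : ‖schrodingerOp V hV ^ k‖ ≤ r ^ k := by
      rcases k.eq_zero_or_pos with h | h
      · rw [h, pow_zero, pow_zero]; exact ContinuousLinearMap.norm_id_le
      · exact (norm_pow_le' _ h).trans (pow_le_pow_left₀ (norm_nonneg _) hr _)
    gcongr
  rw [div_pow, div_mul_eq_mul_div, le_div_iff₀ (by positivity)]
  linarith

end Resolvent

/-! ### The propagator: unitarity, derivative, and short-time decay. -/

section Propagator

open NormedSpace

theorem norm_propagator_le {H : EllTwo →L[ℂ] EllTwo} (hH : IsSelfAdjoint H) (t : ℝ) :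
    ‖propagator H t‖ ≤ 1 := by
  have hA : IsSelfAdjoint (((-t : ℝ) : ℂ) • H) :=
    IsSelfAdjoint.smul (Complex.conj_ofReal _) hH
  have h := (selfAdjoint.expUnitary (A := EllTwo →L[ℂ] EllTwo) ⟨_, hA⟩).2
  have h2 : propagator H t = (selfAdjoint.expUnitary (A := EllTwo →L[ℂ] EllTwo) ⟨_, hA⟩ :
      EllTwo →L[ℂ] EllTwo) := by
    rw [selfAdjoint.expUnitary_coe, propagator, smul_smul]
    congr 2
    push_cast
    ring
  have : Nontrivial EllTwo := ⟨delta 0, 0, fun h => by simpa [h] using norm_delta 0⟩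
  rw [h2]
  exact (CStarRing.norm_of_mem_unitary h).le

theorem hasDerivAt_propagator (H : EllTwo →L[ℂ] EllTwo) (t : ℝ) :
    HasDerivAt (propagator H) (propagator H t * ((-Complex.I) • H)) t := by
  have h := hasDerivAt_exp_smul_const (𝕂 := ℝ) ((-Complex.I) • H) t
  have h2 : ∀ s : ℝ, propagator H s = exp (s • ((-Complex.I) • H)) := by
    intro s
    rw [propagator]
    congr 1
    ext v n
    change -(Complex.I * (s : ℂ)) * H v n = s • (-Complex.I * H v n)
    rw [Complex.real_smul]
    ring
  rw [h2]
  exact h.congr_of_eventuallyEq (Eventually.of_forall h2)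

theorem propagator_zero (H : EllTwo →L[ℂ] EllTwo) : propagator H 0 = 1 := by
  simp [propagator]

/-- Only the powers `k ≥ |n|` of the exponential series reach the site `n`. For these the weight
`e^{k - |n|} ≥ 1` may be inserted, and the weighted series sums to `e^{-|n|} exp(e r)`. -/
theorem norm_propagator_apply_le_of_le_one {V : ℤ → ℝ} {hV : ∃ M : ℝ, ∀ n, |V n| ≤ M} {r : ℝ}
    (hr : ‖schrodingerOp V hV‖ ≤ r) {t : ℝ} (ht0 : 0 ≤ t) (ht : t ≤ 1) (n : ℤ) :
    ‖(propagator (schrodingerOp V hV) t (delta 0)) n‖ ≤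
      Real.exp (-1) ^ n.natAbs * Real.exp (Real.exp 1 * r) := by
  set H := schrodingerOp V hV with hH
  have hr0 : 0 ≤ r := (norm_nonneg _).trans hr
  set A := (-(Complex.I * (t : ℂ))) • H with hA
  have h1 : HasSum (fun k : ℕ => ((k.factorial : ℂ)⁻¹ • A ^ k)) (exp A) :=
    exp_series_hasSum_exp' (𝕂 := ℂ) A
  have h2 : HasSum (fun k : ℕ => evalAt n (((k.factorial : ℂ)⁻¹ • A ^ k) (delta 0)))
      ((propagator H t (delta 0)) n) := by
    have h := (h1.mapL (ContinuousLinearMap.apply ℂ EllTwo (delta 0))).mapL (evalAt n)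
    rw [← evalAt_apply, propagator, ← hA]
    exact h
  have h3 : HasSum (fun k : ℕ => (Real.exp (-1) ^ n.natAbs) *
      ((k.factorial : ℝ)⁻¹ * (Real.exp 1 * r) ^ k))
      (Real.exp (-1) ^ n.natAbs * Real.exp (Real.exp 1 * r)) := by
    have := exp_series_hasSum_exp' (𝕂 := ℝ) (Real.exp 1 * r)
    rw [← Real.exp_eq_exp_ℝ] at this
    exact (this.mul_left _)
  refine h2.norm_le_of_bounded h3 fun k => ?_
  rw [evalAt_apply]
  by_cases hk : k < n.natAbs
  · have h4 : (((k.factorial : ℂ)⁻¹ • A ^ k) (delta 0)) n = 0 := by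
      rw [hA, smul_pow, smul_smul, smul_apply, lp.coeFn_smul, Pi.smul_apply,
        supportedBelow_pow_delta hV k n (by omega), smul_zero]
    rw [h4, norm_zero]
    positivity
  · have hAr : ‖A‖ ≤ r := by
      rw [hA, norm_smul]
      simp only [norm_neg, norm_mul, Complex.norm_I, one_mul, Complex.norm_real, Real.norm_eq_abs,
        abs_of_nonneg ht0]
      calc t * ‖H‖ ≤ 1 * ‖H‖ := by gcongr
        _ ≤ r := by rwa [one_mul]
    have hAk : ‖A ^ k‖ ≤ r ^ k := by
      rcases k.eq_zero_or_pos with h | h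
      · rw [h, pow_zero, pow_zero]; exact ContinuousLinearMap.norm_id_le
      · exact (norm_pow_le' _ h).trans (pow_le_pow_left₀ (norm_nonneg _) hAr _)
    have h5 : ‖(((k.factorial : ℂ)⁻¹ • A ^ k) (delta 0)) n‖ ≤ (k.factorial : ℝ)⁻¹ * r ^ k := by
      refine (norm_apply_le _ _).trans ((ContinuousLinearMap.le_opNorm _ _).trans ?_)
      rw [norm_delta, mul_one, norm_smul, norm_inv, Complex.norm_natCast]
      gcongr
    refine h5.trans ?_
    have h6 : (1 : ℝ) ≤ Real.exp (-1) ^ n.natAbs * Real.exp 1 ^ k := by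
      rw [← Real.exp_nat_mul, ← Real.exp_nat_mul, ← Real.exp_add]
      apply Real.one_le_exp
      have : (n.natAbs : ℝ) ≤ k := by exact_mod_cast not_lt.1 hk
      linarith
    rw [mul_pow]
    have h7 : 0 ≤ (k.factorial : ℝ)⁻¹ * r ^ k := by positivity
    nlinarith [mul_le_mul_of_nonneg_right h6 h7]

end Propagator

/-! ### From the resolvent back to the evolution. -/

section FourierInversion

open scoped FourierTransform

variable {H : EllTwo →L[ℂ] EllTwo} {ε : ℝ}

theorem continuous_propagator (H : EllTwo →L[ℂ] EllTwo) : Continuous (propagator H) :=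
  continuous_iff_continuousAt.2 fun t => (hasDerivAt_propagator H t).continuousAt

theorem continuous_propagator_apply (H : EllTwo →L[ℂ] EllTwo) (v : EllTwo) (n : ℤ) :
    Continuous fun s => (propagator H s v) n := by
  simp_rw [← evalAt_apply]
  exact (evalAt n).continuous.comp ((continuous_propagator H).clm_apply continuous_const)

theorem norm_propagator_apply_le (hH : IsSelfAdjoint H) (t : ℝ) (v : EllTwo) (n : ℤ) :
    ‖(propagator H t v) n‖ ≤ ‖v‖ := by
  refine (norm_apply_le _ _).trans (((propagator H t).le_opNorm v).trans ?_)
  exact mul_le_of_le_one_left (norm_nonneg _) (norm_propagator_le hH t)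

theorem norm_exp_I_mul (z : ℂ) (s : ℝ) :
    ‖Complex.exp (Complex.I * z * s)‖ = Real.exp (-z.im * s) := by
  rw [Complex.norm_exp]
  congr 1
  simp

/-- The Laplace transform of the evolution is the resolvent. -/
theorem integral_exp_mul_propagator (hH : IsSelfAdjoint H) {z : ℂ} (hz : 0 < z.im) {u v : EllTwo}
    (hu : z • u - H u = v) (n : ℤ) :
    ∫ s in Set.Ioi (0 : ℝ), Complex.exp (Complex.I * z * s) * (propagator H s v) n =
      Complex.I * u n := by
  have hderiv : ∀ s ∈ Set.Ici (0 : ℝ),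
      HasDerivAt (fun s : ℝ => Complex.exp (Complex.I * z * s) * (propagator H s u) n)
        (Complex.I * (Complex.exp (Complex.I * z * s) * (propagator H s v) n)) s := by
    intro s _
    have h1 : HasDerivAt (fun s : ℝ => Complex.exp (Complex.I * z * s))
        (Complex.exp (Complex.I * z * s) * (Complex.I * z)) s := by
      have := (((hasDerivAt_id (s : ℂ)).const_mul (Complex.I * z)).cexp).comp_ofReal
      simpa using this
    have h2 : HasDerivAt (fun s : ℝ => evalAt n (propagator H s u))
        (evalAt n ((propagator H s * ((-Complex.I) • H)) u)) s :=
      ((evalAt n).restrictScalars ℝ).hasFDerivAt.comp_hasDerivAt s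
        ((((ContinuousLinearMap.apply ℂ EllTwo u).restrictScalars ℝ).hasFDerivAt).comp_hasDerivAt s
          (hasDerivAt_propagator H s))
    have h3 : (propagator H s * ((-Complex.I) • H)) u =
        (-Complex.I) • (z • propagator H s u - propagator H s v) := by
      rw [← hu, map_sub, map_smul, sub_sub_cancel]
      change propagator H s ((-Complex.I) • H u) = _
      rw [map_smul]
    rw [h3, evalAt_apply] at h2
    simp_rw [evalAt_apply] at h2
    refine (h1.mul h2).congr_deriv ?_
    rw [lp.coeFn_smul, Pi.smul_apply, lp.coeFn_sub, Pi.sub_apply, lp.coeFn_smul, Pi.smul_apply,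
      smul_eq_mul, smul_eq_mul]
    ring
  have hint : IntegrableOn (fun s : ℝ =>
      Complex.I * (Complex.exp (Complex.I * z * s) * (propagator H s v) n)) (Set.Ioi 0) := by
    refine Integrable.mono' ((exp_neg_integrableOn_Ioi 0 hz).mul_const ‖v‖) ?_ ?_
    · refine Continuous.aestronglyMeasurable ?_
      have := continuous_propagator_apply H v n
      fun_prop
    · refine Eventually.of_forall fun s => ?_
      rw [norm_mul, Complex.norm_I, one_mul, norm_mul, norm_exp_I_mul]
      gcongr
      exact norm_propagator_apply_le hH s v n
  have hlim : Tendsto (fun s : ℝ => Complex.exp (Complex.I * z * s) * (propagator H s u) n) atTop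
      (𝓝 0) := by
    have h1 : Tendsto (fun s : ℝ => Real.exp (-z.im * s) * ‖u‖) atTop (𝓝 0) := by
      have : Tendsto (fun s : ℝ => -z.im * s) atTop atBot :=
        tendsto_id.const_mul_atTop_of_neg (neg_lt_zero.2 hz)
      simpa using (Real.tendsto_exp_atBot.comp this).mul_const ‖u‖
    refine squeeze_zero_norm (fun s => ?_) h1
    rw [norm_mul, norm_exp_I_mul]
    gcongr
    exact norm_propagator_apply_le hH s u n
  have h := integral_Ioi_of_hasDerivAt_of_tendsto' hderiv hint hlim
  rw [integral_const_mul] at h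
  have h0 : (propagator H 0 u) n = u n := by rw [propagator_zero]; rfl
  rw [Complex.ofReal_zero, mul_zero, Complex.exp_zero, one_mul, h0, zero_sub] at h
  rw [← neg_neg (u n), ← h, mul_neg, ← mul_assoc, Complex.I_mul_I]
  ring

/-- Off-diagonal matrix elements of the evolution are controlled by those of the resolvent on a
horizontal line. -/
theorem norm_propagator_apply_le_integral (hH : IsSelfAdjoint H) (hε : 0 < ε) {u : ℝ → EllTwo}
    (hu : ∀ E : ℝ, ((E : ℂ) + Complex.I * (ε : ℂ)) • u E - H (u E) = delta 0) {n : ℤ} (hn : n ≠ 0)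
    (hint : Integrable fun E => u E n) {t : ℝ} (ht : 0 < t) :
    ‖(propagator H t (delta 0)) n‖ ≤
      Real.exp (ε * t) * ((2 * Real.pi)⁻¹ * ∫ E, ‖u E n‖) := by
  set f : ℝ → ℂ := fun s =>
    if s ≤ 0 then 0 else (Real.exp (-ε * s) : ℂ) * (propagator H s (delta 0)) n with hf
  -- Pointwise Fourier inversion needs a continuous `f`; there is no jump at `s = 0` because `δ₀(n)
  -- = 0` for `n ≠ 0`.
  have hcont : Continuous f := by
    refine Continuous.if_le continuous_const ?_ continuous_id continuous_const ?_
    · have := continuous_propagator_apply H (delta 0) n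
      fun_prop
    · rintro s rfl
      rw [propagator_zero]
      change 0 = _ * (delta 0 : EllTwo) n
      rw [delta_apply, if_neg hn, mul_zero]
  have hfi : f = Set.indicator (Set.Ioi 0)
      fun s => (Real.exp (-ε * s) : ℂ) * (propagator H s (delta 0)) n := by
    ext s
    by_cases hs : s ≤ 0
    · simp [hf, hs]
    · rw [Set.indicator_of_mem (Set.mem_Ioi.2 (not_le.1 hs))]
      simp only [hf, if_neg hs]
  have hfint : Integrable f := by
    rw [hfi, integrable_indicator_iff measurableSet_Ioi]
    refine Integrable.mono' (exp_neg_integrableOn_Ioi 0 hε) ?_ (Eventually.of_forall fun s => ?_)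
    · refine Continuous.aestronglyMeasurable ?_
      have := continuous_propagator_apply H (delta 0) n
      fun_prop
    · rw [norm_mul, Complex.norm_real, Real.norm_eq_abs, Real.abs_exp]
      refine mul_le_of_le_one_right (Real.exp_pos _).le ?_
      exact (norm_propagator_apply_le hH s _ n).trans (norm_delta 0).le
  have hfourier : 𝓕 f = fun w => Complex.I * u (-(2 * Real.pi) * w) n := by
    ext w
    have hz : (((-(2 * Real.pi) * w : ℝ) : ℂ) + Complex.I * (ε : ℂ)).im = ε := by simp
    rw [Real.fourier_real_eq_integral_exp_smul, hfi,
      ← integral_exp_mul_propagator hH (by rw [hz]; exact hε) (hu (-(2 * Real.pi) * w)) n,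
      ← integral_indicator measurableSet_Ioi]
    congr 1
    ext s
    by_cases hs : s ∈ Set.Ioi (0 : ℝ)
    · rw [Set.indicator_of_mem hs, Set.indicator_of_mem hs, smul_eq_mul, ← mul_assoc,
        Complex.ofReal_exp, ← Complex.exp_add]
      congr 2
      push_cast
      linear_combination -(ε * s : ℂ) * Complex.I_mul_I
    · rw [Set.indicator_of_notMem hs, Set.indicator_of_notMem hs, smul_zero]
  have hpi : -(2 * Real.pi) ≠ 0 := neg_ne_zero.2 (by positivity)
  have hgint : Integrable (𝓕 f) := by
    rw [hfourier]
    exact (hint.comp_mul_left' hpi).const_mul _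
  have hinv := congrFun (hcont.fourierInv_fourier_eq hfint hgint) t
  have hbound : ‖f t‖ ≤ (2 * Real.pi)⁻¹ * ∫ E, ‖u E n‖ := by
    rw [← hinv, Real.fourierInv_eq']
    refine (norm_integral_le_integral_norm _).trans (le_of_eq ?_)
    have h1 : ∀ w : ℝ, ‖Complex.exp (((2 * Real.pi * inner ℝ w t : ℝ) : ℂ) * Complex.I) •
        𝓕 f w‖ = ‖u (-(2 * Real.pi) * w) n‖ := by
      intro w
      rw [norm_smul, Complex.norm_exp_ofReal_mul_I, one_mul, hfourier, norm_mul, Complex.norm_I,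
        one_mul]
    rw [integral_congr_ae (Eventually.of_forall h1),
      Measure.integral_comp_mul_left (fun E => ‖u E n‖), inv_neg, abs_neg,
      abs_of_pos (by positivity), smul_eq_mul]
  have hft : (propagator H t (delta 0)) n = Real.exp (ε * t) * f t := by
    simp only [hf, if_neg (not_le.2 ht)]
    rw [← mul_assoc, ← Complex.ofReal_mul, ← Real.exp_add]
    simp
  rw [hft, norm_mul, Complex.norm_real, Real.norm_eq_abs, Real.abs_exp]
  gcongr

end FourierInversion

/-! ### Existence and continuity of the resolvent off the real axis; Cauchy–Schwarz. -/

section Resolvent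

variable {H : EllTwo →L[ℂ] EllTwo}

theorem mem_resolventSet_of_im_ne_zero (hH : IsSelfAdjoint H) {z : ℂ} (hz : z.im ≠ 0) :
    z ∈ resolventSet ℂ H := by
  by_contra h
  have h2 := hH.mem_spectrum_eq_re (a := H) (show z ∈ spectrum ℂ H from h)
  exact hz (by rw [h2]; simp)

theorem smul_resolvent_sub {z : ℂ} (hz : z ∈ resolventSet ℂ H) (v : EllTwo) :
    z • (resolvent H z v) - H (resolvent H z v) = v := by
  have h : (algebraMap ℂ (EllTwo →L[ℂ] EllTwo) z - H) * resolvent H z = 1 :=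
    Ring.mul_inverse_cancel _ hz
  have h2 := congrArg (fun A : EllTwo →L[ℂ] EllTwo => A v) h
  exact h2

theorem continuous_resolvent_apply (hH : IsSelfAdjoint H) {ε : ℝ} (hε : 0 < ε) (v : EllTwo)
    (n : ℤ) : Continuous fun E : ℝ => (resolvent H ((E : ℂ) + Complex.I * (ε : ℂ)) v) n := by
  have h : Continuous fun E : ℝ => resolvent H ((E : ℂ) + Complex.I * (ε : ℂ)) := by
    refine continuous_iff_continuousAt.2 fun E => ?_
    have hm : (E : ℂ) + Complex.I * (ε : ℂ) ∈ resolventSet ℂ H :=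
      mem_resolventSet_of_im_ne_zero hH (by simpa using hε.ne')
    have h1 := (spectrum.hasDerivAt_resolvent_const_left hm).continuousAt
    have h2 : ContinuousAt (fun E : ℝ => (E : ℂ) + Complex.I * (ε : ℂ)) E := by fun_prop
    exact ContinuousAt.comp (g := resolvent H) h1 h2
  simp_rw [← evalAt_apply]
  exact (evalAt n).continuous.comp (h.clm_apply continuous_const)

end Resolvent

/-- This is Cauchy–Schwarz against the constant 1, obtained by expanding `∫ ((b - a) g - I)² ≥ 0`.
-/
theorem sq_integral_le_mul_integral_sq {g : ℝ → ℝ} (hg : Continuous g) {a b : ℝ} (hab : a < b) :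
    (∫ x in a..b, g x) ^ 2 ≤ (b - a) * ∫ x in a..b, g x ^ 2 := by
  have hba : 0 < b - a := sub_pos.2 hab
  set I := ∫ x in a..b, g x with hI
  have h : 0 ≤ ∫ x in a..b, ((b - a) * g x - I) ^ 2 :=
    intervalIntegral.integral_nonneg hab.le fun x _ => sq_nonneg _
  have h2 : ∫ x in a..b, ((b - a) * g x - I) ^ 2 =
      (b - a) ^ 2 * (∫ x in a..b, g x ^ 2) - 2 * (b - a) * I * I + (b - a) * I ^ 2 := by
    have h3 : ∀ x, ((b - a) * g x - I) ^ 2 =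
        (b - a) ^ 2 * g x ^ 2 - 2 * (b - a) * I * g x + I ^ 2 := fun x => by ring
    simp_rw [h3]
    rw [intervalIntegral.integral_add, intervalIntegral.integral_sub,
      intervalIntegral.integral_const_mul, intervalIntegral.integral_const_mul,
      intervalIntegral.integral_const, smul_eq_mul, ← hI]
    all_goals exact Continuous.intervalIntegrable (by fun_prop) _ _
  rw [h2] at h
  have h4 : 0 ≤ (b - a) * ((b - a) * (∫ x in a..b, g x ^ 2) - I ^ 2) := by nlinarith
  have := nonneg_of_mul_nonneg_right h4 hba
  linarith

/-! ### Site probabilities bounded by resolvent integrals. -/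

section Resolvent

variable {V : ℤ → ℝ} {hV : ∃ M : ℝ, ∀ n, |V n| ≤ M} {K : ℝ}

/-- Off-diagonal decay of the resolvent at energies outside `[-K, K]`. -/
theorem norm_resolvent_apply_le_of_le_abs (hK : 1 < K) (hH : ‖schrodingerOp V hV‖ ≤ K - 1) {E : ℝ}
    (hE : K ≤ |E|) {z : ℂ} (hz : z.re = E) {u : EllTwo}
    (hu : z • u - schrodingerOp V hV u = delta 0) {n : ℤ} (hn : n ≠ 0) :
    ‖u n‖ ≤ ((K - 1) / K) ^ n.natAbs * (2 * K ^ 2 * (1 + E ^ 2)⁻¹) := by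
  have hK0 : 0 < K := by linarith
  have hE0 : 0 < |E| := by linarith
  have hzE : |E| ≤ ‖z‖ := hz ▸ Complex.abs_re_le_norm z
  refine (norm_apply_le_of_norm_le hH (by linarith) hu n).trans ?_
  -- The factor `(K - 1) / K` carries the decay in `n`. As `n ≠ 0`, at least one factor `K / |E|`
  -- remains; together with the one from `(‖z‖ - (K - 1))⁻¹` it gives decay `E⁻²`, integrable at
  -- infinity.
  have h1 : (K - 1) / ‖z‖ = (K - 1) / K * (K / ‖z‖) := by field_simp
  have hk : 1 ≤ n.natAbs := Int.natAbs_pos.2 hn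
  have h2 : (K / ‖z‖) ^ n.natAbs ≤ K / |E| := by
    calc (K / ‖z‖) ^ n.natAbs ≤ (K / |E|) ^ n.natAbs := by gcongr
      _ ≤ (K / |E|) ^ 1 := pow_le_pow_of_le_one (by positivity) ((div_le_one hE0).2 hE) hk
      _ = _ := pow_one _
  have h3 : (‖z‖ - (K - 1))⁻¹ ≤ K / |E| := by
    rw [inv_le_comm₀ (by linarith) (by positivity), inv_div, div_le_iff₀ hK0]
    nlinarith
  have h4 : K / |E| * (K / |E|) ≤ 2 * K ^ 2 * (1 + E ^ 2)⁻¹ := by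
    have : K / |E| * (K / |E|) = K ^ 2 / E ^ 2 := by
      rw [← sq_abs E]; field_simp
    rw [this, ← div_eq_mul_inv, div_le_div_iff₀ (by rw [← sq_abs E]; positivity) (by positivity)]
    have : 1 ≤ E ^ 2 := by rw [← sq_abs E]; nlinarith
    nlinarith [sq_nonneg K]
  have hq : 0 ≤ ((K - 1) / K) ^ n.natAbs := pow_nonneg (div_nonneg (by linarith) hK0.le) _
  rw [h1, mul_pow, mul_assoc]
  refine mul_le_mul_of_nonneg_left (le_trans ?_ h4) hq
  exact mul_le_mul h2 h3 (inv_nonneg.2 (by linarith)) (by positivity)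

theorem integrable_and_integral_resolvent_le (hK : 1 < K) (hH : ‖schrodingerOp V hV‖ ≤ K - 1)
    {ε : ℝ} (hε : 0 < ε) {n : ℤ} (hn : n ≠ 0) :
    Integrable (fun E : ℝ =>
      (resolvent (schrodingerOp V hV) ((E : ℂ) + Complex.I * (ε : ℂ)) (delta 0)) n) ∧
    ∫ E : ℝ, ‖(resolvent (schrodingerOp V hV) ((E : ℂ) + Complex.I * (ε : ℂ)) (delta 0)) n‖ ≤
      (∫ E in (-K)..K,
        ‖(resolvent (schrodingerOp V hV) ((E : ℂ) + Complex.I * (ε : ℂ)) (delta 0)) n‖) +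
      ((K - 1) / K) ^ n.natAbs * (2 * K ^ 2 * Real.pi) := by
  have hsa := isSelfAdjoint_schrodingerOp V hV
  set g : ℝ → ℂ := fun E =>
    (resolvent (schrodingerOp V hV) ((E : ℂ) + Complex.I * (ε : ℂ)) (delta 0)) n with hg
  have hcont : Continuous g := continuous_resolvent_apply hsa hε (delta 0) n
  set q := ((K - 1) / K) ^ n.natAbs with hq
  have hq0 : 0 ≤ q := pow_nonneg (div_nonneg (by linarith) (by linarith)) _
  have hout : ∀ E : ℝ, K ≤ |E| → ‖g E‖ ≤ q * (2 * K ^ 2 * (1 + E ^ 2)⁻¹) := fun E hE =>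
    norm_resolvent_apply_le_of_le_abs hK hH hE (by simp)
      (smul_resolvent_sub (mem_resolventSet_of_im_ne_zero hsa (by simpa using hε.ne')) _) hn
  have hmaj : Integrable fun E : ℝ => q * (2 * K ^ 2 * (1 + E ^ 2)⁻¹) :=
    (integrable_inv_one_add_sq.const_mul _).const_mul _
  have hcompl : ∀ E ∈ (Set.Ioc (-K) K)ᶜ, K ≤ |E| := by
    intro E hE
    rw [Set.mem_compl_iff, Set.mem_Ioc, not_and_or, not_lt, not_le] at hE
    rcases hE with h | h
    · exact le_abs.2 (Or.inr (by linarith))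
    · exact le_abs.2 (Or.inl h.le)
  have hin : IntegrableOn g (Set.Ioc (-K) K) :=
    (hcont.integrableOn_Icc).mono_set Set.Ioc_subset_Icc_self
  have hoff : IntegrableOn g (Set.Ioc (-K) K)ᶜ :=
    Integrable.mono' hmaj.integrableOn hcont.aestronglyMeasurable
      ((ae_restrict_iff' measurableSet_Ioc.compl).2
        (Eventually.of_forall fun E hE => hout E (hcompl E hE)))
  have hgi : Integrable g := by
    rw [← integrableOn_univ, ← Set.union_compl_self (Set.Ioc (-K) K)]
    exact hin.union hoff
  refine ⟨hgi, ?_⟩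
  rw [← integral_add_compl (measurableSet_Ioc (a := -K) (b := K)) hgi.norm,
    intervalIntegral.integral_of_le (by linarith)]
  gcongr
  calc ∫ E in (Set.Ioc (-K) K)ᶜ, ‖g E‖
      ≤ ∫ E in (Set.Ioc (-K) K)ᶜ, q * (2 * K ^ 2 * (1 + E ^ 2)⁻¹) :=
        setIntegral_mono_on hoff.norm hmaj.integrableOn measurableSet_Ioc.compl
          fun E hE => hout E (hcompl E hE)
    _ ≤ ∫ E : ℝ, q * (2 * K ^ 2 * (1 + E ^ 2)⁻¹) :=
        setIntegral_le_integral hmaj (Eventually.of_forall fun E => by positivity)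
    _ = q * (2 * K ^ 2 * Real.pi) := by
        rw [integral_const_mul, integral_const_mul, integral_univ_inv_one_add_sq]

/-- Bound of a site probability at times `t ≥ 1` by the resolvent at imaginary part `1 / t`. -/
theorem siteProb_le_of_one_le (hK : 1 < K) (hH : ‖schrodingerOp V hV‖ ≤ K - 1) {t : ℝ}
    (ht : 1 ≤ t) {n : ℤ} (hn : n ≠ 0) :
    siteProb (schrodingerOp V hV) t n ≤
      4 * K * (∫ E in (-K)..K, ‖(resolvent (schrodingerOp V hV)
        ((E : ℂ) + Complex.I * ((t⁻¹ : ℝ) : ℂ)) (delta 0)) n‖ ^ 2) +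
      8 * Real.pi ^ 2 * K ^ 4 * (((K - 1) / K) ^ 2) ^ n.natAbs := by
  have ht0 : 0 < t := by linarith
  have hε : 0 < t⁻¹ := inv_pos.2 ht0
  have hsa := isSelfAdjoint_schrodingerOp V hV
  obtain ⟨hint, hle⟩ := integrable_and_integral_resolvent_le hK hH hε hn
  have hcont := continuous_resolvent_apply hsa hε (delta 0) n
  have hmain := norm_propagator_apply_le_integral hsa hε (fun E => smul_resolvent_sub
    (mem_resolventSet_of_im_ne_zero hsa (by simpa using ht0.ne')) (delta 0)) hn hint ht0
  rw [inv_mul_cancel₀ ht0.ne'] at hmain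
  set g : ℝ → ℂ := fun E =>
    (resolvent (schrodingerOp V hV) ((E : ℂ) + Complex.I * ((t⁻¹ : ℝ) : ℂ)) (delta 0)) n with hg
  set q := ((K - 1) / K) ^ n.natAbs with hq
  have hq0 : 0 ≤ q := pow_nonneg (div_nonneg (by linarith) (by linarith)) _
  have hcs := sq_integral_le_mul_integral_sq hcont.norm (a := -K) (b := K) (by linarith)
  set A := ∫ E in (-K)..K, ‖g E‖ with hA
  set B := ∫ E in (-K)..K, ‖g E‖ ^ 2 with hB
  have hA0 : 0 ≤ A := intervalIntegral.integral_nonneg (by linarith) fun _ _ => norm_nonneg _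
  have hconst : Real.exp 1 * (2 * Real.pi)⁻¹ ≤ 1 := by
    rw [← div_eq_mul_inv, div_le_one (by positivity)]
    linarith [Real.exp_one_lt_d9, Real.pi_gt_three]
  have h1 : ‖(propagator (schrodingerOp V hV) t (delta 0)) n‖ ≤
      A + q * (2 * K ^ 2 * Real.pi) := by
    refine hmain.trans ?_
    rw [← mul_assoc]
    refine le_trans (mul_le_of_le_one_left (integral_nonneg fun _ => norm_nonneg _) hconst) hle
  rw [siteProb_eq]
  have h2 := pow_le_pow_left₀ (norm_nonneg _) h1 2
  have h3 : (((K - 1) / K) ^ 2) ^ n.natAbs = q ^ 2 := by rw [hq, ← pow_mul, ← pow_mul, mul_comm]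
  rw [h3]
  nlinarith [sq_nonneg (A - q * (2 * K ^ 2 * Real.pi))]

theorem siteProb_le_of_le_one (hK : 4 ≤ K) (hH : ‖schrodingerOp V hV‖ ≤ K - 1) {t : ℝ}
    (ht0 : 0 ≤ t) (ht : t ≤ 1) (n : ℤ) :
    siteProb (schrodingerOp V hV) t n ≤
      Real.exp (Real.exp 1 * (K - 1)) ^ 2 * (((K - 1) / K) ^ 2) ^ n.natAbs := by
  have h := norm_propagator_apply_le_of_le_one hH ht0 ht n
  -- The rate `e⁻¹` is weakened to `(K - 1) / K` so that short and long times share one constant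
  -- `c`.
  have hq : Real.exp (-1) ≤ (K - 1) / K := by
    rw [Real.exp_neg, inv_le_comm₀ (Real.exp_pos _) (div_pos (by linarith) (by linarith)), inv_div,
      div_le_iff₀ (by linarith)]
    nlinarith [Real.exp_one_gt_d9]
  have h1 : ‖(propagator (schrodingerOp V hV) t (delta 0)) n‖ ≤
      ((K - 1) / K) ^ n.natAbs * Real.exp (Real.exp 1 * (K - 1)) := by
    refine h.trans ?_
    gcongr
  rw [siteProb_eq]
  refine (pow_le_pow_left₀ (norm_nonneg _) h1 2).trans (le_of_eq ?_)
  rw [mul_pow, pow_right_comm, mul_comm]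

end Resolvent

/-! ### Resolvent tails bounded by transfer matrices. -/

section TransferMatrix

theorem transferNorm_zero (V : ℤ → ℝ) (z : ℂ) : transferNorm V 0 z = 1 := by
  have h : transferMatrix V 0 z = 1 := by simp [transferMatrix, forwardProd]
  rw [transferNorm, h, map_one]
  exact nnnorm_one

theorem one_le_maxTransferNormSq (V : ℤ → ℝ) {S : Finset ℤ} (hS : (0 : ℤ) ∈ S) (z : ℂ) :
    1 ≤ maxTransferNormSq V S z := by
  have h : transferNorm V 0 z ^ 2 ≤ S.sup fun n => transferNorm V n z ^ 2 :=
    Finset.le_sup (f := fun n => transferNorm V n z ^ 2) hS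
  rw [transferNorm_zero, one_pow] at h
  exact_mod_cast h

theorem exists_maxTransferNormSq_eq (V : ℤ → ℝ) {S : Finset ℤ} (hS : S.Nonempty) (z : ℂ) :
    ∃ m ∈ S, maxTransferNormSq V S z = (transferNorm V m z : ℝ) ^ 2 := by
  obtain ⟨m, hm, h⟩ := Finset.exists_mem_eq_sup S hS fun n => transferNorm V n z ^ 2
  exact ⟨m, hm, by rw [maxTransferNormSq, h, NNReal.coe_pow]⟩

theorem continuous_forwardProd (V : ℤ → ℝ) (k : ℕ) : Continuous fun z => forwardProd V z k := by
  induction k with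
  | zero => exact continuous_const
  | succ k ih =>
    refine Continuous.matrix_mul ?_ ih
    refine continuous_matrix fun i j => ?_
    fin_cases i <;> fin_cases j <;> simp [stepMatrix] <;> fun_prop

theorem continuous_backwardProd (V : ℤ → ℝ) (k : ℕ) : Continuous fun z => backwardProd V z k := by
  induction k with
  | zero => exact continuous_const
  | succ k ih =>
    refine Continuous.matrix_mul ?_ ih
    simp_rw [stepMatrix_inv]
    refine continuous_matrix fun i j => ?_
    fin_cases i <;> fin_cases j <;> simp <;> fun_prop

theorem continuous_transferNorm (V : ℤ → ℝ) (n : ℤ) : Continuous (transferNorm V n) := by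
  have h : Continuous fun z => transferMatrix V n z := by
    unfold transferMatrix
    split_ifs
    · exact continuous_forwardProd V _
    · exact continuous_backwardProd V _
  have h2 : Continuous (Matrix.toEuclideanCLM (n := Fin 2) (𝕜 := ℂ)) :=
    LinearMap.continuous_of_finiteDimensional
      (Matrix.toEuclideanCLM (n := Fin 2) (𝕜 := ℂ)).toAlgEquiv.toLinearMap
  exact (h2.comp h).nnnorm

theorem continuous_maxTransferNormSq (V : ℤ → ℝ) (S : Finset ℤ) :
    Continuous (maxTransferNormSq V S) := by
  have h : Continuous fun z => S.sup fun n => transferNorm V n z ^ 2 :=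
    Continuous.finset_sup_apply fun n _ => (continuous_transferNorm V n).pow 2
  exact NNReal.continuous_coe.comp h

/-- The sites from `N` on lie in the tail beyond any `k < N`, so `k` is free to be the index where
the maximum is attained. -/
theorem sum_range_mul_transferFrobSq_le {a x : ℕ → ℂ} {ε B D : ℝ} (hε : 0 < ε)
    (ha : ∀ n, (a n).im = ε) (hB : ∀ n, ‖a n‖ ≤ B) (hx : IsRecurrenceSol a x)
    (hs : Summable fun n => ‖x n‖ ^ 2) (hD : ‖x 0‖ ^ 2 + ‖x 1‖ ^ 2 ≤ D) {k N : ℕ} (hkN : k < N)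
    (M : ℕ) :
    (∑ j ∈ Finset.range M, ‖x (N + j)‖ ^ 2) * transferFrobSq a k ≤
      (2 * B ^ 2 + 3) * ε⁻¹ ^ 2 * D := by
  have hs' : Summable fun j => ‖x (k + 1 + j)‖ ^ 2 := by
    refine ((summable_nat_add_iff (k + 1)).2 hs).congr fun j => ?_
    rw [add_comm]
  have h1 : ∑ j ∈ Finset.range M, ‖x (N + j)‖ ^ 2 ≤ ∑' j, ‖x (k + 1 + j)‖ ^ 2 := by
    have h := hs'.sum_le_tsum (Finset.Ico (N - (k + 1)) (N - (k + 1) + M))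
      (fun _ _ => by positivity)
    rw [Finset.sum_Ico_eq_sum_range, Nat.add_sub_cancel_left] at h
    have hshift : ∀ j, k + 1 + (N - (k + 1) + j) = N + j := fun j => by omega
    simp_rw [hshift] at h
    exact h
  have h0 : 0 ≤ transferFrobSq a k := by unfold transferFrobSq; positivity
  refine (mul_le_mul_of_nonneg_right h1 h0).trans
    ((tsum_tail_mul_transferFrobSq_le hε ha hB hx hs k).trans ?_)
  gcongr

variable {V : ℤ → ℝ} {hV : ∃ M : ℝ, ∀ n, |V n| ≤ M} {K t : ℝ}

theorem resolvent_recurrence {z : ℂ} {u : EllTwo}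
    (hu : z • u - schrodingerOp V hV u = delta 0) {n : ℤ} (hn : n ≠ 0) :
    u (n + 1) = (z - V n) * u n - u (n - 1) := by
  have h := congrArg (fun v : EllTwo => v n) hu
  simp only [lp.coeFn_sub, Pi.sub_apply, lp.coeFn_smul, Pi.smul_apply, smul_eq_mul,
    schrodingerOp_apply, delta_apply, if_neg hn] at h
  linear_combination -h

theorem norm_sub_potential_le (hH : ‖schrodingerOp V hV‖ ≤ K - 1) (ht : 1 ≤ t) {E : ℝ}
    (hE : |E| ≤ K) (n : ℤ) :
    ‖(E : ℂ) + Complex.I * ((t⁻¹ : ℝ) : ℂ) - V n‖ ≤ 2 * K := by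
  have h1 := (abs_potential_le V hV n).trans hH
  have h2 : |t⁻¹| ≤ 1 := by
    rw [abs_of_pos (by positivity)]; exact inv_le_one_of_one_le₀ ht
  calc ‖(E : ℂ) + Complex.I * ((t⁻¹ : ℝ) : ℂ) - V n‖
      ≤ ‖(E : ℂ)‖ + ‖Complex.I * ((t⁻¹ : ℝ) : ℂ)‖ + ‖(V n : ℂ)‖ :=
        (norm_sub_le _ _).trans (add_le_add_left (norm_add_le _ _) _)
    _ = |E| + |t⁻¹| + |V n| := by
        rw [norm_mul, Complex.norm_I, one_mul, Complex.norm_real, Complex.norm_real,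
          Complex.norm_real]; rfl
    _ ≤ 2 * K := by linarith

/-- Resolvent bound in terms of transfer matrices to the right of the origin. -/
theorem sum_resolvent_sq_le_right (hH : ‖schrodingerOp V hV‖ ≤ K - 1) (ht : 1 ≤ t) {E : ℝ}
    (hE : |E| ≤ K) {u : EllTwo}
    (hu : ((E : ℂ) + Complex.I * ((t⁻¹ : ℝ) : ℂ)) • u - schrodingerOp V hV u = delta 0)
    {N : ℕ} (hN : 1 ≤ N) (M : ℕ) :
    ∑ j ∈ Finset.range M, ‖u (N + j : ℤ)‖ ^ 2 ≤ (8 * K ^ 2 + 3) ^ 2 * (t ^ 4 *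
      (maxTransferNormSq V (Finset.Icc 0 ((N : ℤ) - 1))
        ((E : ℂ) + Complex.I * ((t⁻¹ : ℝ) : ℂ)))⁻¹) := by
  have hB := norm_sub_potential_le (V := V) (hV := hV) hH ht hE
  set z := (E : ℂ) + Complex.I * ((t⁻¹ : ℝ) : ℂ) with hz
  have ht0 : 0 < t := by linarith
  have hzim : z.im = t⁻¹ := by simp [hz]
  have h0S : (0 : ℤ) ∈ Finset.Icc 0 ((N : ℤ) - 1) := Finset.mem_Icc.2 ⟨le_rfl, by omega⟩
  have hpos := zero_lt_one.trans_le (one_le_maxTransferNormSq V h0S z)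
  obtain ⟨m, hm, hmax⟩ := exists_maxTransferNormSq_eq V ⟨0, h0S⟩ z
  rw [Finset.mem_Icc] at hm
  lift m to ℕ using hm.1
  have hnorm : ‖u‖ ≤ t := by
    have := norm_le_inv_of_im (isSelfAdjoint_schrodingerOp V hV) (by rw [hzim]; positivity) hu
    rwa [hzim, inv_inv, norm_delta, mul_one] at this
  have hsq : ∀ n, ‖u n‖ ^ 2 ≤ t ^ 2 := fun n =>
    pow_le_pow_left₀ (norm_nonneg _) ((norm_apply_le u n).trans hnorm) 2
  have hx : IsRecurrenceSol (fun n => z - V (n + 1)) (fun n : ℕ => u n) := by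
    intro n
    have h := resolvent_recurrence hu (n := (n : ℤ) + 1) (by omega)
    push_cast
    rw [add_sub_cancel_right] at h
    exact h
  -- `2 * t ^ 2` would suffice for `D`; the larger value is the one needed on the left, so both
  -- sides share a constant. The factor `ε⁻² = t²` and `D` together produce `t ^ 4`.
  have key := sum_range_mul_transferFrobSq_le (D := (8 * K ^ 2 + 3) * t ^ 2) (B := 2 * K)
    (inv_pos.2 ht0) (fun n => by simp [hzim])
    (fun n => hB _) hx
    ((ellTwo_summable u).comp_injective Nat.cast_injective)
    (by nlinarith [hsq (0 : ℕ), hsq (1 : ℕ), mul_nonneg (sq_nonneg K) (sq_nonneg t)])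
    (show m < N by omega) M
  have hle := sq_transferNorm_natCast_le V z m
  rw [← hmax] at hle
  rw [← mul_assoc, ← div_eq_mul_inv, le_div_iff₀ hpos]
  refine (mul_le_mul_of_nonneg_left hle (Finset.sum_nonneg fun _ _ => by positivity)).trans ?_
  simp_rw [Nat.cast_add] at key
  rw [inv_inv] at key
  refine key.trans (le_of_eq ?_)
  ring

/-- Resolvent bound in terms of transfer matrices to the left of the origin. -/
theorem sum_resolvent_sq_le_left (hH : ‖schrodingerOp V hV‖ ≤ K - 1) (ht : 1 ≤ t) {E : ℝ}
    (hE : |E| ≤ K) {u : EllTwo}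
    (hu : ((E : ℂ) + Complex.I * ((t⁻¹ : ℝ) : ℂ)) • u - schrodingerOp V hV u = delta 0)
    {N : ℕ} (hN : 1 ≤ N) (M : ℕ) :
    ∑ j ∈ Finset.range M, ‖u (-(N + j : ℤ))‖ ^ 2 ≤ (8 * K ^ 2 + 3) ^ 2 * (t ^ 4 *
      (maxTransferNormSq V (Finset.Icc (-(N : ℤ) + 1) 0)
        ((E : ℂ) + Complex.I * ((t⁻¹ : ℝ) : ℂ)))⁻¹) := by
  have hB := norm_sub_potential_le (V := V) (hV := hV) hH ht hE
  set z := (E : ℂ) + Complex.I * ((t⁻¹ : ℝ) : ℂ) with hz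
  have ht0 : 0 < t := by linarith
  have hzim : z.im = t⁻¹ := by simp [hz]
  have h0S : (0 : ℤ) ∈ Finset.Icc (-(N : ℤ) + 1) 0 := Finset.mem_Icc.2 ⟨by omega, le_rfl⟩
  have hpos := zero_lt_one.trans_le (one_le_maxTransferNormSq V h0S z)
  obtain ⟨m, hm, hmax⟩ := exists_maxTransferNormSq_eq V ⟨0, h0S⟩ z
  rw [Finset.mem_Icc] at hm
  obtain ⟨k, rfl⟩ : ∃ k : ℕ, m = -(k : ℤ) := ⟨m.natAbs, by omega⟩
  have hnorm : ‖u‖ ≤ t := by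
    have := norm_le_inv_of_im (isSelfAdjoint_schrodingerOp V hV) (by rw [hzim]; positivity) hu
    rwa [hzim, inv_inv, norm_delta, mul_one] at this
  have hsq : ∀ n, ‖u n‖ ^ 2 ≤ t ^ 2 := fun n =>
    pow_le_pow_left₀ (norm_nonneg _) ((norm_apply_le u n).trans hnorm) 2
  -- The source `δ₀` breaks the recurrence at the origin, so `x 0` is not `u 1`: it is the value
  -- that continues the solution on `n ≤ 0` homogeneously to the site 1.
  let x : ℕ → ℂ
    | 0 => (z - V 0) * u 0 - u (-1)
    | n + 1 => u (-(n : ℤ))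
  have hx : IsRecurrenceSol (fun n => z - V (-n)) x := by
    intro n
    rcases n with _ | n
    · change u (-((0 + 1 : ℕ) : ℤ)) = (z - V (-((0 : ℕ) : ℤ))) * u (-((0 : ℕ) : ℤ)) -
        ((z - V 0) * u 0 - u (-1))
      simp
    · change u (-((n + 1 + 1 : ℕ) : ℤ)) = (z - V (-((n + 1 : ℕ) : ℤ))) * u (-((n + 1 : ℕ) : ℤ)) -
        u (-(n : ℤ))
      have h := resolvent_recurrence hu (n := -((n + 1 : ℕ) : ℤ)) (by omega)
      rw [show -((n + 1 : ℕ) : ℤ) + 1 = -(n : ℤ) by push_cast; ring,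
        show -((n + 1 : ℕ) : ℤ) - 1 = -((n + 1 + 1 : ℕ) : ℤ) by push_cast; ring] at h
      rw [h]
      ring
  have hsum : Summable fun n => ‖x n‖ ^ 2 := by
    rw [← summable_nat_add_iff 1]
    exact (ellTwo_summable u).comp_injective (neg_injective.comp Nat.cast_injective)
  have hD : ‖x 0‖ ^ 2 + ‖x 1‖ ^ 2 ≤ (8 * K ^ 2 + 3) * t ^ 2 := by
    have h0 : ‖x 0‖ ^ 2 ≤ 2 * ‖(z - V 0) * u 0‖ ^ 2 + 2 * ‖u (-1)‖ ^ 2 := norm_sub_sq_le _ _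
    have h1 : ‖x 1‖ ^ 2 ≤ t ^ 2 := hsq _
    have h2 : ‖(z - V 0) * u 0‖ ^ 2 ≤ (2 * K) ^ 2 * t ^ 2 := by
      rw [norm_mul, mul_pow]
      exact mul_le_mul (pow_le_pow_left₀ (norm_nonneg _) (hB 0) 2) (hsq 0) (sq_nonneg _)
        (sq_nonneg _)
    nlinarith [hsq (-1)]
  -- Because `x (n + 1)` is `u (-n)`, the sites from `-N` leftwards correspond to indices from `N +
  -- 1` on.
  have key := sum_range_mul_transferFrobSq_le (B := 2 * K)
    (inv_pos.2 ht0) (fun n => by simp [hzim]) (fun n => hB _) hx hsum hD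
    (show k < N + 1 by omega) M
  have hxN : ∀ j, x (N + 1 + j) = u (-(N + j : ℤ)) := by
    intro j
    rw [add_right_comm]
    change u (-((N + j : ℕ) : ℤ)) = _
    rw [Nat.cast_add]
  simp_rw [hxN] at key
  have hle := sq_transferNorm_neg_natCast_le V z k
  rw [← hmax] at hle
  rw [← mul_assoc, ← div_eq_mul_inv, le_div_iff₀ hpos]
  refine (mul_le_mul_of_nonneg_left hle (Finset.sum_nonneg fun _ _ => by positivity)).trans ?_
  rw [inv_inv] at key
  refine key.trans (le_of_eq ?_)
  ring

end TransferMatrix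

/-! ### Summation over sites and the final bound. -/

/-- The natural numbers enumerate `[N, ∞)`. -/
def natEquivIci (N : ℤ) : ℕ ≃ Set.Ici N where
  toFun j := ⟨N + j, by simp⟩
  invFun n := ((n : ℤ) - N).toNat
  left_inv j := by simp
  right_inv n := by
    have := Set.mem_Ici.1 n.2
    ext
    simp only
    omega

/-- The natural numbers enumerate `(-∞, -N]`. -/
def natEquivIicNeg (N : ℤ) : ℕ ≃ Set.Iic (-N) where
  toFun j := ⟨-(N + j), by simp⟩
  invFun n := (-(n : ℤ) - N).toNat
  left_inv j := by simp
  right_inv n := by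
    have := Set.mem_Iic.1 n.2
    ext
    simp only
    omega

theorem rightOutsideProb_eq_tsum (H : EllTwo →L[ℂ] EllTwo) (N : ℤ) (t : ℝ) :
    rightOutsideProb H N t = ∑' j : ℕ, siteProb H t (N + j) :=
  ((natEquivIci N).tsum_eq fun n => siteProb H t n).symm

theorem leftOutsideProb_eq_tsum (H : EllTwo →L[ℂ] EllTwo) (N : ℤ) (t : ℝ) :
    leftOutsideProb H N t = ∑' j : ℕ, siteProb H t (-(N + j)) :=
  ((natEquivIicNeg N).tsum_eq fun n => siteProb H t n).symm

theorem sum_range_pow_add_le {r : ℝ} (hr0 : 0 ≤ r) (hr1 : r < 1) (N M : ℕ) :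
    ∑ j ∈ Finset.range M, r ^ (N + j) ≤ (1 - r)⁻¹ * r ^ N := by
  simp_rw [pow_add]
  rw [← Finset.mul_sum, mul_comm, ← tsum_geometric_of_lt_one hr0 hr1]
  gcongr
  exact (summable_geometric_of_lt_one hr0 hr1).sum_le_tsum _ fun _ _ => by positivity

/-- The constant in the bound for the outside probabilities. -/
def outsideConst (K : ℝ) : ℝ :=
  (1 - ((K - 1) / K) ^ 2)⁻¹ *
      (Real.exp (Real.exp 1 * (K - 1)) ^ 2 + 8 * Real.pi ^ 2 * K ^ 4) +
    4 * K * (8 * K ^ 2 + 3) ^ 2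

/-- Both half-lines are treated at once, `σ` enumerating either. Bounds uniform in `M` on partial
sums suffice, so only finite sums are exchanged with the energy integral. -/
theorem tsum_siteProb_le {K : ℝ} (hK : 4 ≤ K) {V : ℤ → ℝ} {hV : ∃ M : ℝ, ∀ n, |V n| ≤ M}
    (hH : ‖schrodingerOp V hV‖ ≤ K - 1) {N : ℕ} (hN : 1 ≤ N) {t : ℝ} (ht : 0 < t) {σ : ℕ → ℤ}
    (hσ : ∀ j, (σ j).natAbs = N + j) {F : ℝ → ℝ} (hF : Continuous F) (hF0 : ∀ E, 0 ≤ F E)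
    (hle : 1 ≤ t → ∀ E : ℝ, |E| ≤ K → ∀ M,
      ∑ j ∈ Finset.range M, ‖(resolvent (schrodingerOp V hV)
        ((E : ℂ) + Complex.I * ((t⁻¹ : ℝ) : ℂ)) (delta 0)) (σ j)‖ ^ 2 ≤
      (8 * K ^ 2 + 3) ^ 2 * (t ^ 4 * F E)) :
    ∑' j, siteProb (schrodingerOp V hV) t (σ j) ≤
      outsideConst K * ((((K - 1) / K) ^ 2) ^ N + t ^ 4 * ∫ E in (-K)..K, F E) := by
  set r := ((K - 1) / K) ^ 2 with hr
  have hq0 : 0 ≤ (K - 1) / K := div_nonneg (by linarith) (by linarith)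
  have hq1 : (K - 1) / K < 1 := by rw [div_lt_one (by linarith)]; linarith
  have hr0 : 0 ≤ r := sq_nonneg _
  have hr1 : r < 1 := pow_lt_one₀ hq0 hq1 two_ne_zero
  have hr1' : 0 < 1 - r := by linarith
  have hI0 : 0 ≤ t ^ 4 * ∫ E in (-K)..K, F E :=
    mul_nonneg (by positivity)
      (intervalIntegral.integral_nonneg (by linarith) fun E _ => hF0 E)
  have hgeom : ∀ (A : ℝ), 0 ≤ A → ∀ M,
      ∑ j ∈ Finset.range M, A * r ^ (σ j).natAbs ≤ (1 - r)⁻¹ * A * r ^ N := by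
    intro A hA M
    simp_rw [hσ]
    rw [← Finset.mul_sum]
    have := mul_le_mul_of_nonneg_left (sum_range_pow_add_le hr0 hr1 N M) hA
    linarith
  refine Real.tsum_le_of_sum_range_le (fun j => sq_nonneg _) fun M => ?_
  have hrN : 0 ≤ r ^ N := by positivity
  set A₁ := Real.exp (Real.exp 1 * (K - 1)) ^ 2 with hA₁
  set A₂ := 8 * Real.pi ^ 2 * K ^ 4 with hA₂
  have hA₁0 : 0 ≤ A₁ := by positivity
  have hA₂0 : 0 ≤ A₂ := by positivity
  have hB0 : 0 ≤ 4 * K * (8 * K ^ 2 + 3) ^ 2 := by positivity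
  have hC₁ : 0 ≤ (1 - r)⁻¹ * A₁ := by positivity
  have hC₂ : 0 ≤ (1 - r)⁻¹ * A₂ := by positivity
  have hC : outsideConst K = (1 - r)⁻¹ * A₁ + (1 - r)⁻¹ * A₂ + 4 * K * (8 * K ^ 2 + 3) ^ 2 := by
    rw [outsideConst, mul_add]
  set I := t ^ 4 * ∫ E in (-K)..K, F E with hI
  -- For `t ≤ 1` the exponential term alone is enough; the nonnegative integral term is added for
  -- free.
  rcases le_total t 1 with ht1 | ht1
  · have h1 : ∑ j ∈ Finset.range M, siteProb (schrodingerOp V hV) t (σ j) ≤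
        (1 - r)⁻¹ * A₁ * r ^ N :=
      (Finset.sum_le_sum fun j _ => siteProb_le_of_le_one hK hH ht.le ht1 (σ j)).trans
        (hgeom A₁ hA₁0 M)
    rw [hC]
    nlinarith [mul_nonneg hC₁ hI0, mul_nonneg hC₂ hI0, mul_nonneg hB0 hI0, mul_nonneg hC₂ hrN,
      mul_nonneg hB0 hrN]
  · have hσ0 : ∀ j, σ j ≠ 0 := fun j h => by
      have := hσ j
      rw [h] at this
      simp at this
      omega
    have hcont : ∀ j, Continuous fun E : ℝ => ‖(resolvent (schrodingerOp V hV)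
        ((E : ℂ) + Complex.I * ((t⁻¹ : ℝ) : ℂ)) (delta 0)) (σ j)‖ ^ 2 := fun j =>
      (continuous_resolvent_apply (isSelfAdjoint_schrodingerOp V hV) (inv_pos.2 ht) (delta 0)
        (σ j)).norm.pow 2
    have h2 : ∑ j ∈ Finset.range M, ∫ E in (-K)..K, ‖(resolvent (schrodingerOp V hV)
        ((E : ℂ) + Complex.I * ((t⁻¹ : ℝ) : ℂ)) (delta 0)) (σ j)‖ ^ 2 ≤
        (8 * K ^ 2 + 3) ^ 2 * I := by
      rw [← intervalIntegral.integral_finsetSum fun j _ =>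
        (hcont j).intervalIntegrable _ _, hI,
        ← intervalIntegral.integral_const_mul, ← intervalIntegral.integral_const_mul]
      refine intervalIntegral.integral_mono_on (by linarith)
        (Continuous.intervalIntegrable
          (continuous_finsetSum _ fun j _ => hcont j) _ _)
        (Continuous.intervalIntegrable (by fun_prop) _ _) fun E hE => ?_
      exact hle ht1 E (abs_le.2 hE) M
    have h1 : ∑ j ∈ Finset.range M, siteProb (schrodingerOp V hV) t (σ j) ≤
        4 * K * ((8 * K ^ 2 + 3) ^ 2 * I) + (1 - r)⁻¹ * A₂ * r ^ N := by
      refine (Finset.sum_le_sum fun j _ => siteProb_le_of_one_le (by linarith) hH ht1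
        (hσ0 j)).trans ?_
      rw [Finset.sum_add_distrib, ← Finset.mul_sum]
      exact add_le_add (mul_le_mul_of_nonneg_left h2 (by linarith)) (hgeom A₂ hA₂0 M)
    rw [hC]
    nlinarith [mul_nonneg hC₁ hI0, mul_nonneg hC₂ hI0, mul_nonneg hC₁ hrN, mul_nonneg hB0 hrN]

end

theorem theorem1 (K : ℝ) (hK : 4 ≤ K) :
    ∃ C c : ℝ, 0 < C ∧ 0 < c ∧
      ∀ (V : ℤ → ℝ) (hV : ∃ M : ℝ, ∀ n, |V n| ≤ M),
        spectrum ℂ (schrodingerOp V hV) ⊆ (fun x : ℝ => (x : ℂ)) '' Set.Icc (-K + 1) (K - 1) →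
        ∀ (N : ℕ) (t : ℝ), 1 ≤ N → 0 < t →
          rightOutsideProb (schrodingerOp V hV) N t ≤
              C * (Real.exp (-c * N) + t ^ 4 * ∫ E in (-K)..K,
                (maxTransferNormSq V (Finset.Icc 0 ((N : ℤ) - 1))
                  ((E : ℂ) + Complex.I * ((t⁻¹ : ℝ) : ℂ)))⁻¹) ∧
          leftOutsideProb (schrodingerOp V hV) N t ≤
              C * (Real.exp (-c * N) + t ^ 4 * ∫ E in (-K)..K,
                (maxTransferNormSq V (Finset.Icc (-(N : ℤ) + 1) 0)
                  ((E : ℂ) + Complex.I * ((t⁻¹ : ℝ) : ℂ)))⁻¹) := by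
  have hq0 : 0 < (K - 1) / K := div_pos (by linarith) (by linarith)
  have hq1 : (K - 1) / K < 1 := by rw [div_lt_one (by linarith)]; linarith
  have hr0 : 0 < ((K - 1) / K) ^ 2 := by positivity
  have hr1 : ((K - 1) / K) ^ 2 < 1 := pow_lt_one₀ hq0.le hq1 two_ne_zero
  -- This `c` makes `e^{-cN}` exactly the geometric factor `(((K - 1) / K) ^ 2) ^ N`.
  refine ⟨outsideConst K, -Real.log (((K - 1) / K) ^ 2), ?_,
    neg_pos.2 (Real.log_neg hr0 hr1), fun V hV hspec N t hN ht => ?_⟩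
  · have : 0 < 1 - ((K - 1) / K) ^ 2 := by linarith
    rw [outsideConst]
    positivity
  have hexp : Real.exp (-(-Real.log (((K - 1) / K) ^ 2)) * N) = (((K - 1) / K) ^ 2) ^ N := by
    rw [neg_neg, mul_comm, Real.exp_nat_mul, Real.exp_log hr0]
  rw [hexp]
  have hsa := isSelfAdjoint_schrodingerOp V hV
  have hH : ‖schrodingerOp V hV‖ ≤ K - 1 :=
    norm_le_of_spectrum_subset hsa (by linarith) (by rwa [neg_sub', sub_neg_eq_add])
  have hu : ∀ E : ℝ, ((E : ℂ) + Complex.I * ((t⁻¹ : ℝ) : ℂ)) • resolvent (schrodingerOp V hV)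
      ((E : ℂ) + Complex.I * ((t⁻¹ : ℝ) : ℂ)) (delta 0) - schrodingerOp V hV
      (resolvent (schrodingerOp V hV) ((E : ℂ) + Complex.I * ((t⁻¹ : ℝ) : ℂ)) (delta 0)) =
        delta 0 := fun E =>
    smul_resolvent_sub (mem_resolventSet_of_im_ne_zero hsa (by simpa using ht.ne')) _
  have hF : ∀ S : Finset ℤ, (0 : ℤ) ∈ S → Continuous (fun E : ℝ =>
      (maxTransferNormSq V S ((E : ℂ) + Complex.I * ((t⁻¹ : ℝ) : ℂ)))⁻¹) ∧
      ∀ E : ℝ, 0 ≤ (maxTransferNormSq V S ((E : ℂ) + Complex.I * ((t⁻¹ : ℝ) : ℂ)))⁻¹ := by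
    intro S hS
    refine ⟨Continuous.inv₀ ((continuous_maxTransferNormSq V S).comp (by fun_prop)) fun E => ?_,
      fun E => inv_nonneg.2 (zero_le_one.trans (one_le_maxTransferNormSq V hS _))⟩
    exact (zero_lt_one.trans_le (one_le_maxTransferNormSq V hS _)).ne'
  constructor
  · obtain ⟨h1, h2⟩ := hF (Finset.Icc 0 ((N : ℤ) - 1)) (Finset.mem_Icc.2 ⟨le_rfl, by omega⟩)
    rw [rightOutsideProb_eq_tsum]
    exact tsum_siteProb_le hK hH hN ht (fun j => by omega) h1 h2
      fun ht1 E hE M => sum_resolvent_sq_le_right hH ht1 hE (hu E) hN M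
  · obtain ⟨h1, h2⟩ := hF (Finset.Icc (-(N : ℤ) + 1) 0) (Finset.mem_Icc.2 ⟨by omega, le_rfl⟩)
    rw [leftOutsideProb_eq_tsum]
    exact tsum_siteProb_le hK hH hN ht (fun j => by omega) h1 h2
      fun ht1 E hE M => sum_resolvent_sq_le_left hH ht1 hE (hu E) hN M
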